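/- Let $\mathbb K\in\{\mathbb R,\mathbb C\}$. For $n\in\{1,2\}$ let $\mathcal G(\mathbb R^n)=\mathcal E_{\mathrm M}(\mathbb R^n)/\mathcal N(\mathbb R^n)$ be the (special) Colombeau algebra of $\mathbb K$-valued generalized functions: $\mathcal E_{\mathrm M}(\mathbb R^n)$ consists of the families $(u_\varepsilon)_{\varepsilon\in(0,1]}$ of smooth functions $u_\varepsilon:\mathbb R^n\to\mathbb K$ such that for every compact $K\subset\mathbb R^n$ and every $\alpha\in\mathbb N_0^n$ there is $p\ge 0$ with $\sup_{K}|\partial^\alpha u_\varepsilon|=\mathcal O(\varepsilon^{-p})$ as $\varepsilon\to0$, and $\mathcal N(\mathbb R^n)$ of those families of smooth functions for which $\sup_{K}|\partial^\alpha u_\varepsilon|=\mathcal O(\varepsilon^{q})$ for all compact $K$, all $\alpha$ and all $q\ge0$. Partial derivatives, the restriction $u|_{\{t=0\}}$ of $u\in\mathcal G(\mathbb R^2)$, and the superposition $f(u)$ are defined on representatives. Fix $\varphi^{(n)}\in\mathcal S(\mathbb R^n)$ with $\int\varphi^{(n)}=1$ and $\int x^\alpha\varphi^{(n)}(x)\,dx=0$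 for all $|\alpha|\ge1$, and a compactly supported smooth function $\chi^{(n)}$ equal to one near $0$ (all $\mathbb K$-valued), put $\varphi^{(n)}_\varepsilon(x)=\varepsilon^{-n}\varphi^{(n)}(x/\varepsilon)$, and embed locally integrable (in particular smooth) functions $g$ on $\mathbb R^n$ into $\mathcal G(\mathbb R^n)$ by $\iota(g)=$ class of $\big(g*(\chi^{(n)}\varphi^{(n)}_\varepsilon)\big)_{\varepsilon\in(0,1]}$. Let $f:\mathbb K\to\mathbb K$ be smooth (in the real sense) with all derivatives of at most polynomial growth, globally Lipschitz, and with $f(0)=0$. Let $a,b\in C^\infty(\mathbb R)$ and $h\in C^\infty(\mathbb R^2)$ be $\mathbb K$-valued. Then the Cauchy problem $$\partial_t^2 w-\partial_x^2 w=f(w)+h\ \text{ on }\mathbb R^2,\qquad w(x,0)=a(x),\quad \partial_t w(x,0)=b(x)\quad(x\in\mathbb R)$$ has exactly one classical solution $w\in C^2(\mathbb R^2)$; this $w$ belongs to $C^\infty(\mathbb R^2)$; and the corresponding problem in the Colombeau algebra, $$\partial_t^2 u-\partial_x^2 u=f(u)+\iota(h)\ \text{ in }\mathcal G(\mathbb R^2),\qquad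 u|_{\{t=0\}}=\iota(a),\quad \partial_t u|_{\{t=0\}}=\iota(b)\ \text{ in }\mathcal G(\mathbb R),$$ has exactly one solution $u\in\mathcal G(\mathbb R^2)$, namely $u=\iota(w)$. -/

import Mathlib

open Set Filter Topology MeasureTheory
open scoped ContDiff

set_option linter.unusedSectionVars false

noncomputable section

namespace Colombeau

/-- The parameter set `(0,1]` of the regularization parameter `ε`. -/
abbrev Eps : Type := Set.Ioc (0 : ℝ) 1

/-- The filter `ε → 0` on `(0,1]`. -/
def epsZero : Filter Eps := comap (fun ε : Eps => (ε : ℝ)) (𝓝 0)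

universe u v

section Orders

variable {X : Type*} {F : Type*} [NormedAddCommGroup F] {G : Type*} [NormedAddCommGroup G]

/-- `sup_{x ∈ K} ‖u_ε(x)‖ = O(ε ^ m)` as `ε → 0`. -/
def IsOrder (K : Set X) (m : ℤ) (w : Eps → X → F) : Prop :=
  ∃ C : ℝ, ∀ᶠ ε in epsZero, ∀ x ∈ K, ‖w ε x‖ ≤ C * (ε : ℝ) ^ m

/-- Polynomially bounded growth on `K`: `∃ p ≥ 0`, `sup_K ‖u_ε‖ = O(ε ^ (-p))`. -/
def ModOn (K : Set X) (w : Eps → X → F) : Prop := ∃ p : ℕ, IsOrder K (-(p : ℤ)) w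

/-- Rapid decay on `K`: `∀ q ≥ 0`, `sup_K ‖u_ε‖ = O(ε ^ q)`. -/
def NullOn (K : Set X) (w : Eps → X → F) : Prop := ∀ q : ℕ, IsOrder K (q : ℤ) w

lemma IsOrder.mono_exp {K : Set X} {m m' : ℤ} {w : Eps → X → F} (h : IsOrder K m w)
    (hm : m' ≤ m) : IsOrder K m' w := by
  obtain ⟨C, hC⟩ := h
  refine ⟨max C 0, hC.mono fun ε hε x hx => (hε x hx).trans ?_⟩
  have h0 : (0 : ℝ) < ε := ε.2.1
  have h1 : (ε : ℝ) ^ m ≤ (ε : ℝ) ^ m' := zpow_le_zpow_right_of_le_one₀ h0 ε.2.2 hm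
  have h2 : 0 < (ε : ℝ) ^ m := zpow_pos h0 m
  exact mul_le_mul (le_max_left _ _) h1 h2.le (le_max_right _ _)

lemma IsOrder.of_le {K : Set X} {m : ℤ} {w : Eps → X → F} {w' : Eps → X → G}
    (h : IsOrder K m w) (hle : ∀ ε, ∀ x ∈ K, ‖w' ε x‖ ≤ ‖w ε x‖) : IsOrder K m w' := by
  obtain ⟨C, hC⟩ := h
  exact ⟨C, hC.mono fun ε hε x hx => (hle ε x hx).trans (hε x hx)⟩

lemma IsOrder.add {K : Set X} {m : ℤ} {w w' : Eps → X → F} (h : IsOrder K m w)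
    (h' : IsOrder K m w') : IsOrder K m (fun ε x => w ε x + w' ε x) := by
  obtain ⟨C, hC⟩ := h
  obtain ⟨C', hC'⟩ := h'
  refine ⟨C + C', ?_⟩
  filter_upwards [hC, hC'] with ε h1 h2 x hx
  calc ‖w ε x + w' ε x‖ ≤ ‖w ε x‖ + ‖w' ε x‖ := norm_add_le _ _
    _ ≤ (C + C') * (ε : ℝ) ^ m := by rw [add_mul]; exact add_le_add (h1 x hx) (h2 x hx)

lemma IsOrder.mul {K : Set X} {m m' : ℤ} {w w' : Eps → X → ℝ} (h : IsOrder K m w)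
    (h' : IsOrder K m' w') : IsOrder K (m + m') (fun ε x => w ε x * w' ε x) := by
  obtain ⟨C, hC⟩ := h
  obtain ⟨C', hC'⟩ := h'
  refine ⟨C * C', ?_⟩
  filter_upwards [hC, hC'] with ε h1 h2 x hx
  have h0 : (ε : ℝ) ≠ 0 := ε.2.1.ne'
  rw [norm_mul, zpow_add₀ h0, mul_mul_mul_comm]
  exact mul_le_mul (h1 x hx) (h2 x hx) (norm_nonneg _) ((norm_nonneg _).trans (h1 x hx))

lemma IsOrder.const (K : Set X) (c : F) : IsOrder K 0 (fun _ _ => c) :=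
  ⟨‖c‖, Eventually.of_forall fun ε x _ => by simp⟩

lemma ModOn.of_le {K : Set X} {w : Eps → X → F} {w' : Eps → X → G} (h : ModOn K w)
    (hle : ∀ ε, ∀ x ∈ K, ‖w' ε x‖ ≤ ‖w ε x‖) : ModOn K w' :=
  ⟨h.choose, h.choose_spec.of_le hle⟩

lemma NullOn.of_le {K : Set X} {w : Eps → X → F} {w' : Eps → X → G} (h : NullOn K w)
    (hle : ∀ ε, ∀ x ∈ K, ‖w' ε x‖ ≤ ‖w ε x‖) : NullOn K w' :=
  fun q => (h q).of_le hle

lemma ModOn.norm {K : Set X} {w : Eps → X → F} (h : ModOn K w) :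
    ModOn K (fun ε x => ‖w ε x‖) := h.of_le fun _ _ _ => by simp

lemma NullOn.norm {K : Set X} {w : Eps → X → F} (h : NullOn K w) :
    NullOn K (fun ε x => ‖w ε x‖) := h.of_le fun _ _ _ => by simp

lemma ModOn.add {K : Set X} {w w' : Eps → X → F} (h : ModOn K w) (h' : ModOn K w') :
    ModOn K (fun ε x => w ε x + w' ε x) := by
  obtain ⟨p, hp⟩ := h
  obtain ⟨q, hq⟩ := h'
  exact ⟨p + q, (hp.mono_exp (by push_cast; lia)).add (hq.mono_exp (by push_cast; lia))⟩

lemma NullOn.add {K : Set X} {w w' : Eps → X → F} (h : NullOn K w) (h' : NullOn K w') :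
    NullOn K (fun ε x => w ε x + w' ε x) := fun q => (h q).add (h' q)

lemma ModOn.const (K : Set X) (c : F) : ModOn K (fun _ _ => c) :=
  ⟨0, by simpa using IsOrder.const K c⟩

lemma NullOn.zero (K : Set X) : NullOn K (fun _ _ => (0 : F)) := fun q =>
  ⟨0, Eventually.of_forall fun ε x _ => by simp⟩

lemma ModOn.mul {K : Set X} {w w' : Eps → X → ℝ} (h : ModOn K w) (h' : ModOn K w') :
    ModOn K (fun ε x => w ε x * w' ε x) := by
  obtain ⟨p, hp⟩ := h
  obtain ⟨q, hq⟩ := h'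
  exact ⟨p + q, (hp.mul hq).mono_exp (by push_cast; lia)⟩

lemma ModOn.mul_null {K : Set X} {w w' : Eps → X → ℝ} (h : ModOn K w) (h' : NullOn K w') :
    NullOn K (fun ε x => w ε x * w' ε x) := by
  obtain ⟨p, hp⟩ := h
  exact fun q => (hp.mul (h' (p + q))).mono_exp (by push_cast; lia)

lemma ModOn.sum {ι : Type*} {K : Set X} (s : Finset ι) {w : ι → Eps → X → F}
    (h : ∀ i ∈ s, ModOn K (w i)) : ModOn K (fun ε x => ∑ i ∈ s, w i ε x) := by
  classical
  induction s using Finset.induction_on with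
  | empty => simpa using ModOn.const K (0 : F)
  | insert a s ha ih =>
    simp only [Finset.sum_insert ha]
    exact (h a (by simp)).add (ih fun i hi => h i (by simp [hi]))

lemma NullOn.sum {ι : Type*} {K : Set X} (s : Finset ι) {w : ι → Eps → X → F}
    (h : ∀ i ∈ s, NullOn K (w i)) : NullOn K (fun ε x => ∑ i ∈ s, w i ε x) := by
  classical
  induction s using Finset.induction_on with
  | empty => simpa using NullOn.zero (F := F) K
  | insert a s ha ih =>
    simp only [Finset.sum_insert ha]
    exact (h a (by simp)).add (ih fun i hi => h i (by simp [hi]))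

lemma NullOn.modOn {K : Set X} {w : Eps → X → F} (h : NullOn K w) : ModOn K w :=
  ⟨0, by simpa using h 0⟩

end Orders

section Nets

variable {E : Type*} [NormedAddCommGroup E] [NormedSpace ℝ E]
variable {F : Type*} [NormedAddCommGroup F] [NormedSpace ℝ F]
variable {G : Type*} [NormedAddCommGroup G] [NormedSpace ℝ G]
variable {H : Type*} [NormedAddCommGroup H] [NormedSpace ℝ H]

/-- Moderate families of smooth functions: on each compact set every derivative is
`O(ε ^ (-p))` for some `p`. All partial derivatives of order `k` are collected in
`iteratedFDeriv ℝ k`. -/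
def IsModerate (w : Eps → E → F) : Prop :=
  (∀ ε, ContDiff ℝ ∞ (w ε)) ∧
    ∀ K : Set E, IsCompact K → ∀ k : ℕ, ∃ p : ℕ,
      IsOrder K (-(p : ℤ)) (fun ε => iteratedFDeriv ℝ k (w ε))

/-- Null families of smooth functions: on each compact set every derivative is
`O(ε ^ q)` for all `q`. -/
def IsNull (w : Eps → E → F) : Prop :=
  (∀ ε, ContDiff ℝ ∞ (w ε)) ∧
    ∀ K : Set E, IsCompact K → ∀ k : ℕ, ∀ q : ℕ,
      IsOrder K (q : ℤ) (fun ε => iteratedFDeriv ℝ k (w ε))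

lemma modOn_bilin (B : F →L[ℝ] G →L[ℝ] H) {K : Set E} {a : Eps → E → F} {b : Eps → E → G}
    (ha : ∀ ε, ContDiff ℝ ∞ (a ε)) (hb : ∀ ε, ContDiff ℝ ∞ (b ε)) (k : ℕ)
    (hak : ∀ i ≤ k, ModOn K (fun ε => iteratedFDeriv ℝ i (a ε)))
    (hbk : ∀ i ≤ k, ModOn K (fun ε => iteratedFDeriv ℝ i (b ε))) :
    ModOn K (fun ε => iteratedFDeriv ℝ k (fun x => B (a ε x) (b ε x))) := by
  refine ModOn.of_le (w := fun ε x => ‖B‖ * ∑ i ∈ Finset.range (k + 1),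
      (k.choose i : ℝ) * ‖iteratedFDeriv ℝ i (a ε) x‖ * ‖iteratedFDeriv ℝ (k - i) (b ε) x‖) ?_ ?_
  · refine (ModOn.const K ‖B‖).mul (ModOn.sum _ fun i hi => ?_)
    have hi' : i ≤ k := by simp at hi; lia
    exact ((ModOn.const K _).mul (hak i hi').norm).mul (hbk (k - i) (by lia)).norm
  · intro ε x _
    exact (B.norm_iteratedFDeriv_le_of_bilinear (ha ε) (hb ε) x
      (by exact_mod_cast le_top)).trans (Real.le_norm_self _)

lemma nullOn_bilin_right (B : F →L[ℝ] G →L[ℝ] H) {K : Set E} {a : Eps → E → F}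
    {b : Eps → E → G}
    (ha : ∀ ε, ContDiff ℝ ∞ (a ε)) (hb : ∀ ε, ContDiff ℝ ∞ (b ε)) (k : ℕ)
    (hak : ∀ i ≤ k, ModOn K (fun ε => iteratedFDeriv ℝ i (a ε)))
    (hbk : ∀ i ≤ k, NullOn K (fun ε => iteratedFDeriv ℝ i (b ε))) :
    NullOn K (fun ε => iteratedFDeriv ℝ k (fun x => B (a ε x) (b ε x))) := by
  refine NullOn.of_le (w := fun ε x => ‖B‖ * ∑ i ∈ Finset.range (k + 1),
      (k.choose i : ℝ) * ‖iteratedFDeriv ℝ i (a ε) x‖ * ‖iteratedFDeriv ℝ (k - i) (b ε) x‖) ?_ ?_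
  · refine (ModOn.const K ‖B‖).mul_null (NullOn.sum _ fun i hi => ?_)
    have hi' : i ≤ k := by simp at hi; lia
    exact ((ModOn.const K _).mul (hak i hi').norm).mul_null (hbk (k - i) (by lia)).norm
  · intro ε x _
    exact (B.norm_iteratedFDeriv_le_of_bilinear (ha ε) (hb ε) x
      (by exact_mod_cast le_top)).trans (Real.le_norm_self _)

lemma nullOn_bilin_left (B : F →L[ℝ] G →L[ℝ] H) {K : Set E} {a : Eps → E → F}
    {b : Eps → E → G}
    (ha : ∀ ε, ContDiff ℝ ∞ (a ε)) (hb : ∀ ε, ContDiff ℝ ∞ (b ε)) (k : ℕ)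
    (hak : ∀ i ≤ k, NullOn K (fun ε => iteratedFDeriv ℝ i (a ε)))
    (hbk : ∀ i ≤ k, ModOn K (fun ε => iteratedFDeriv ℝ i (b ε))) :
    NullOn K (fun ε => iteratedFDeriv ℝ k (fun x => B (a ε x) (b ε x))) :=
  nullOn_bilin_right B.flip hb ha k hbk hak

lemma modOn_deriv_const (K : Set E) (c : F) (k : ℕ) :
    ModOn K (fun _ : Eps => iteratedFDeriv ℝ k (fun _ : E => c)) := by
  rcases Nat.eq_zero_or_pos k with rfl | hk
  · exact (ModOn.const K c).of_le fun ε x _ => by simp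
  · refine (ModOn.const K (0 : F)).of_le fun ε x _ => ?_
    rw [iteratedFDeriv_const_of_ne (by lia)]
    simp

lemma IsModerate.const (c : F) : IsModerate (fun (_ : Eps) (_ : E) => c) :=
  ⟨fun _ => contDiff_const, fun K _ k => modOn_deriv_const K c k⟩

lemma IsNull.isModerate {w : Eps → E → F} (h : IsNull w) : IsModerate w :=
  ⟨h.1, fun K hK k => NullOn.modOn (h.2 K hK k)⟩

lemma IsModerate.add {w w' : Eps → E → F} (h : IsModerate w) (h' : IsModerate w') :
    IsModerate (fun ε x => w ε x + w' ε x) := by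
  refine ⟨fun ε => (h.1 ε).add (h'.1 ε), fun K hK k => ?_⟩
  refine ModOn.of_le (ModOn.add (h.2 K hK k) (h'.2 K hK k)) fun ε x _ => le_of_eq ?_
  rw [fun_iteratedFDeriv_add ((h.1 ε).of_le (by exact_mod_cast le_top))
    ((h'.1 ε).of_le (by exact_mod_cast le_top))]

lemma IsNull.add {w w' : Eps → E → F} (h : IsNull w) (h' : IsNull w') :
    IsNull (fun ε x => w ε x + w' ε x) := by
  refine ⟨fun ε => (h.1 ε).add (h'.1 ε), fun K hK k => ?_⟩
  refine NullOn.of_le (NullOn.add (h.2 K hK k) (h'.2 K hK k)) fun ε x _ => le_of_eq ?_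
  rw [fun_iteratedFDeriv_add ((h.1 ε).of_le (by exact_mod_cast le_top))
    ((h'.1 ε).of_le (by exact_mod_cast le_top))]

lemma IsNull.zero : IsNull (fun (_ : Eps) (_ : E) => (0 : F)) := by
  refine ⟨fun _ => contDiff_const, fun K _ k => ?_⟩
  refine (NullOn.zero (F := F) K).of_le fun ε x _ => ?_
  simp [show (fun _ : E => (0 : F)) = 0 from rfl]

lemma IsModerate.bilin (B : F →L[ℝ] G →L[ℝ] H) {a : Eps → E → F} {b : Eps → E → G}
    (ha : IsModerate a) (hb : IsModerate b) : IsModerate (fun ε x => B (a ε x) (b ε x)) :=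
  ⟨fun ε => (B.isBoundedBilinearMap.contDiff.comp ((ha.1 ε).prodMk (hb.1 ε)) :),
    fun K hK k => modOn_bilin B ha.1 hb.1 k (fun i _ => ha.2 K hK i) fun i _ => hb.2 K hK i⟩

lemma IsNull.bilin_right (B : F →L[ℝ] G →L[ℝ] H) {a : Eps → E → F} {b : Eps → E → G}
    (ha : IsModerate a) (hb : IsNull b) : IsNull (fun ε x => B (a ε x) (b ε x)) :=
  ⟨fun ε => (B.isBoundedBilinearMap.contDiff.comp ((ha.1 ε).prodMk (hb.1 ε)) :),
    fun K hK k => nullOn_bilin_right B ha.1 hb.1 k (fun i _ => ha.2 K hK i) fun i _ => hb.2 K hK i⟩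

/-- The derivative of a function in the direction `v`. -/
def dirDeriv (v : E) (g : E → F) : E → F := fun x => fderiv ℝ g x v

lemma contDiff_dirDeriv (v : E) {g : E → F} (hg : ContDiff ℝ ∞ g) :
    ContDiff ℝ ∞ (dirDeriv v g) :=
  (hg.fderiv_right (m := ∞) (by simp)).clm_apply contDiff_const

lemma norm_iteratedFDeriv_dirDeriv (v : E) {g : E → F} (hg : ContDiff ℝ ∞ g) (k : ℕ) (x : E) :
    ‖iteratedFDeriv ℝ k (dirDeriv v g) x‖ ≤ ‖v‖ * ‖iteratedFDeriv ℝ (k + 1) g x‖ := by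
  rw [← norm_iteratedFDeriv_fderiv]
  exact norm_iteratedFDeriv_clm_apply_const
    ((hg.fderiv_right (m := ∞) (by simp)).contDiffAt) (by exact_mod_cast le_top)

lemma IsModerate.dirDeriv (v : E) {w : Eps → E → F} (h : IsModerate w) :
    IsModerate (fun ε => dirDeriv v (w ε)) :=
  ⟨fun ε => contDiff_dirDeriv v (h.1 ε), fun K hK k =>
    ((ModOn.const K ‖v‖).mul (ModOn.norm (h.2 K hK (k + 1)))).of_le fun ε x _ =>
      (norm_iteratedFDeriv_dirDeriv v (h.1 ε) k x).trans (Real.le_norm_self _)⟩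

lemma IsNull.dirDeriv (v : E) {w : Eps → E → F} (h : IsNull w) :
    IsNull (fun ε => dirDeriv v (w ε)) :=
  ⟨fun ε => contDiff_dirDeriv v (h.1 ε), fun K hK k =>
    ((ModOn.const K ‖v‖).mul_null (NullOn.norm (h.2 K hK (k + 1)))).of_le fun ε x _ =>
      (norm_iteratedFDeriv_dirDeriv v (h.1 ε) k x).trans (Real.le_norm_self _)⟩

variable {E' : Type*} [NormedAddCommGroup E'] [NormedSpace ℝ E']

lemma norm_iteratedFDeriv_pullback (L : E' →L[ℝ] E) {g : E → F} (hg : ContDiff ℝ ∞ g)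
    (k : ℕ) (x : E') :
    ‖iteratedFDeriv ℝ k (fun y => g (L y)) x‖ ≤ ‖L‖ ^ k * ‖iteratedFDeriv ℝ k g (L x)‖ := by
  have := L.iteratedFDeriv_comp_right hg x (i := k) (by exact_mod_cast le_top)
  rw [show (fun y => g (L y)) = g ∘ L from rfl, this]
  refine (ContinuousMultilinearMap.norm_compContinuousLinearMap_le _ _).trans ?_
  simp [mul_comm]

lemma IsModerate.pullback (L : E' →L[ℝ] E) {w : Eps → E → F} (h : IsModerate w) :
    IsModerate (fun ε y => w ε (L y)) := by
  refine ⟨fun ε => (h.1 ε).comp L.contDiff, fun K hK k => ?_⟩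
  obtain ⟨p, C, hC⟩ := h.2 (L '' K) (hK.image L.continuous) k
  have h1 : ModOn K (fun ε y => iteratedFDeriv ℝ k (w ε) (L y)) :=
    ⟨p, C, hC.mono fun ε hε y hy => hε _ (mem_image_of_mem _ hy)⟩
  exact ((ModOn.const K (‖L‖ ^ k)).mul h1.norm).of_le fun ε y _ =>
    (norm_iteratedFDeriv_pullback L (h.1 ε) k y).trans (Real.le_norm_self _)

lemma IsNull.pullback (L : E' →L[ℝ] E) {w : Eps → E → F} (h : IsNull w) :
    IsNull (fun ε y => w ε (L y)) := by
  refine ⟨fun ε => (h.1 ε).comp L.contDiff, fun K hK k => ?_⟩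
  have h1 : NullOn K (fun ε y => iteratedFDeriv ℝ k (w ε) (L y)) := fun q => by
    obtain ⟨C, hC⟩ := h.2 (L '' K) (hK.image L.continuous) k q
    exact ⟨C, hC.mono fun ε hε y hy => hε _ (mem_image_of_mem _ hy)⟩
  exact ((ModOn.const K (‖L‖ ^ k)).mul_null h1.norm).of_le fun ε y _ =>
    (norm_iteratedFDeriv_pullback L (h.1 ε) k y).trans (Real.le_norm_self _)

end Nets

section Superposition

variable {E : Type*} [NormedAddCommGroup E] [NormedSpace ℝ E]
variable {A : Type u} [NormedAddCommGroup A] [NormedSpace ℝ A]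

lemma temperate_fderiv {F : Type*} [NormedAddCommGroup F] [NormedSpace ℝ F] {f : A → F}
    (hf : f.HasTemperateGrowth) : (fderiv ℝ f).HasTemperateGrowth := by
  refine ⟨hf.1.fderiv_right (m := ∞) (by simp), fun n => ?_⟩
  obtain ⟨k, C, h⟩ := hf.2 (n + 1)
  exact ⟨k, C, fun x => by rw [norm_iteratedFDeriv_fderiv]; exact h x⟩

lemma modOn_temperate {X : Type*} {F : Type*} [NormedAddCommGroup F] [NormedSpace ℝ F] {f : A → F}
    (hf : f.HasTemperateGrowth) {K : Set X} {w : Eps → X → A} (hw : ModOn K w) :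
    ModOn K (fun ε x => f (w ε x)) := by
  obtain ⟨k, C, h⟩ := hf.2 0
  have h1 : ModOn K (fun ε x => 1 + ‖w ε x‖) := (ModOn.const K 1).add hw.norm
  have h2 : ∀ n : ℕ, ModOn K (fun ε x => (1 + ‖w ε x‖) ^ n) := by
    intro n
    induction n with
    | zero => simpa using ModOn.const K (1 : ℝ)
    | succ n ih => simpa only [pow_succ] using ih.mul h1
  refine ((ModOn.const K C).mul (h2 k)).of_le fun ε x _ => ?_
  have := h (w ε x)
  rw [norm_iteratedFDeriv_zero] at this
  exact this.trans (Real.le_norm_self _)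

lemma fderiv_superpos {F : Type*} [NormedAddCommGroup F] [NormedSpace ℝ F] {f : A → F}
    (hf : ContDiff ℝ ∞ f) {g : E → A} (hg : ContDiff ℝ ∞ g) :
    fderiv ℝ (fun x => f (g x)) =
      fun x => ContinuousLinearMap.compL ℝ E A F (fderiv ℝ f (g x)) (fderiv ℝ g x) := by
  funext x
  exact fderiv_fun_comp x (hf.differentiable (by simp) _) (hg.differentiable (by simp) _)

lemma modOn_superpos {K : Set E} {w : Eps → E → A} (hw : ∀ ε, ContDiff ℝ ∞ (w ε))
    (hK : ∀ k, ModOn K (fun ε => iteratedFDeriv ℝ k (w ε))) (k : ℕ) :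
    ∀ {F : Type u} [NormedAddCommGroup F] [NormedSpace ℝ F] {f : A → F},
      f.HasTemperateGrowth →
      ModOn K (fun ε => iteratedFDeriv ℝ k (fun x => f (w ε x))) := by
  induction k using Nat.strong_induction_on with
  | _ k ih =>
    intro F _ _ f hf
    have h0 : ModOn K w := (hK 0).of_le fun ε x _ => by simp
    rcases k with _ | k
    · exact (modOn_temperate hf h0).of_le fun ε x _ => by simp
    · have key : ModOn K (fun ε => iteratedFDeriv ℝ k (fun x =>
          ContinuousLinearMap.compL ℝ E A F (fderiv ℝ f (w ε x)) (fderiv ℝ (w ε) x))) := by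
        refine modOn_bilin _
          (fun ε => (hf.1.fderiv_right (m := ∞) (by simp)).comp (hw ε))
          (fun ε => (hw ε).fderiv_right (m := ∞) (by simp)) k
          (fun i hi => ih i (by lia) (temperate_fderiv hf)) fun i _ => ?_
        exact (hK (i + 1)).of_le fun ε x _ => by rw [norm_iteratedFDeriv_fderiv]
      refine key.of_le fun ε x _ => ?_
      rw [← norm_iteratedFDeriv_fderiv, fderiv_superpos hf.1 (hw ε)]

lemma nullOn_superpos_zero {X : Type*} {F : Type*} [NormedAddCommGroup F] [NormedSpace ℝ F]
    {f : A → F} (hf : f.HasTemperateGrowth) {K : Set X} {w w' : Eps → X → A}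
    (hw : ModOn K w) (hw' : ModOn K w') (hd : NullOn K (fun ε x => w ε x - w' ε x)) :
    NullOn K (fun ε x => f (w ε x) - f (w' ε x)) := by
  obtain ⟨k, C, h⟩ := hf.2 1
  have hC : 0 ≤ C := by
    have := (norm_nonneg _).trans (h 0)
    simpa using this
  have h1 : ModOn K (fun ε x => 1 + (‖w ε x‖ + ‖w' ε x‖)) :=
    (ModOn.const K 1).add (hw.norm.add hw'.norm)
  have h2 : ∀ n : ℕ, ModOn K (fun ε x => (1 + (‖w ε x‖ + ‖w' ε x‖)) ^ n) := by
    intro n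
    induction n with
    | zero => simpa using ModOn.const K (1 : ℝ)
    | succ n ih => simpa only [pow_succ] using ih.mul h1
  refine (((ModOn.const K C).mul (h2 k)).mul_null hd.norm).of_le fun ε x _ => ?_
  refine le_trans ?_ (Real.le_norm_self _)
  set R := ‖w ε x‖ + ‖w' ε x‖ with hR
  refine Convex.norm_image_sub_le_of_norm_fderiv_le (𝕜 := ℝ) (s := Metric.closedBall (0 : A) R)
    (fun y _ => hf.1.differentiable (by simp) y) (fun y hy => ?_) (convex_closedBall _ _) ?_ ?_
  · have h3 := h y
    rw [← norm_iteratedFDeriv_fderiv, norm_iteratedFDeriv_zero] at h3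
    refine h3.trans ?_
    have : ‖y‖ ≤ R := by simpa using hy
    gcongr
  · simp [hR]
  · simp [hR]

lemma nullOn_superpos {K : Set E} {w w' : Eps → E → A} (hw : ∀ ε, ContDiff ℝ ∞ (w ε))
    (hw' : ∀ ε, ContDiff ℝ ∞ (w' ε))
    (hK : ∀ k, ModOn K (fun ε => iteratedFDeriv ℝ k (w ε)))
    (hK' : ∀ k, ModOn K (fun ε => iteratedFDeriv ℝ k (w' ε)))
    (hd : ∀ k, NullOn K (fun ε => iteratedFDeriv ℝ k (fun x => w ε x - w' ε x))) (k : ℕ) :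
    ∀ {F : Type u} [NormedAddCommGroup F] [NormedSpace ℝ F] {f : A → F},
      f.HasTemperateGrowth →
      NullOn K (fun ε => iteratedFDeriv ℝ k (fun x => f (w ε x) - f (w' ε x))) := by
  induction k using Nat.strong_induction_on with
  | _ k ih =>
    intro F _ _ f hf
    have h0 : ModOn K w := (hK 0).of_le fun ε x _ => by simp
    have h0' : ModOn K w' := (hK' 0).of_le fun ε x _ => by simp
    have hd0 : NullOn K (fun ε x => w ε x - w' ε x) := (hd 0).of_le fun ε x _ => by simp
    rcases k with _ | k
    · exact (nullOn_superpos_zero hf h0 h0' hd0).of_le fun ε x _ => by simp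
    · have hf' : ∀ {g : E → A}, ContDiff ℝ ∞ g → ContDiff ℝ ∞ (fun x => fderiv ℝ f (g x)) :=
        fun hg => (hf.1.fderiv_right (m := ∞) (by simp)).comp hg
      have hg' : ∀ {g : E → A}, ContDiff ℝ ∞ g → ContDiff ℝ ∞ (fderiv ℝ g) :=
        fun hg => hg.fderiv_right (m := ∞) (by simp)
      have k1 : NullOn K (fun ε => iteratedFDeriv ℝ k (fun x =>
          ContinuousLinearMap.compL ℝ E A F (fderiv ℝ f (w ε x) - fderiv ℝ f (w' ε x))
            (fderiv ℝ (w ε) x))) :=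
        nullOn_bilin_left _ (fun ε => (hf' (hw ε)).sub (hf' (hw' ε))) (fun ε => hg' (hw ε)) k
          (fun i hi => ih i (by lia) (temperate_fderiv hf))
          fun i _ => (hK (i + 1)).of_le fun ε x _ => by rw [norm_iteratedFDeriv_fderiv]
      have k2 : NullOn K (fun ε => iteratedFDeriv ℝ k (fun x =>
          ContinuousLinearMap.compL ℝ E A F (fderiv ℝ f (w' ε x))
            (fderiv ℝ (fun y => w ε y - w' ε y) x))) :=
        nullOn_bilin_right _ (fun ε => hf' (hw' ε)) (fun ε => hg' ((hw ε).sub (hw' ε))) k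
          (fun i _ => modOn_superpos hw' hK' i (temperate_fderiv hf))
          fun i _ => (hd (i + 1)).of_le fun ε x _ => by rw [norm_iteratedFDeriv_fderiv]
      refine (k1.add k2).of_le fun ε x _ => le_of_eq ?_
      rw [← norm_iteratedFDeriv_fderiv]
      have hdiff : ∀ {g : E → A}, ContDiff ℝ ∞ g → Differentiable ℝ (fun x => f (g x)) :=
        fun hg => (hf.1.comp hg).differentiable (by simp)
      have e1 : fderiv ℝ (fun x => f (w ε x) - f (w' ε x)) = fun x =>
          ContinuousLinearMap.compL ℝ E A F (fderiv ℝ f (w ε x) - fderiv ℝ f (w' ε x))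
            (fderiv ℝ (w ε) x) +
          ContinuousLinearMap.compL ℝ E A F (fderiv ℝ f (w' ε x))
            (fderiv ℝ (fun y => w ε y - w' ε y) x) := by
        funext x
        rw [fderiv_fun_sub (hdiff (hw ε) x) (hdiff (hw' ε) x),
          congrFun (fderiv_superpos hf.1 (hw ε)) x, congrFun (fderiv_superpos hf.1 (hw' ε)) x,
          fderiv_fun_sub ((hw ε).differentiable (by simp) x)
            ((hw' ε).differentiable (by simp) x)]
        simp
      have hsm : ∀ B : (A →L[ℝ] F) →L[ℝ] (E →L[ℝ] A) →L[ℝ] (E →L[ℝ] F),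
          ∀ {a : E → (A →L[ℝ] F)} {b : E → (E →L[ℝ] A)}, ContDiff ℝ ∞ a → ContDiff ℝ ∞ b →
          ContDiff ℝ k (fun x => B (a x) (b x)) := fun B a b ha hb =>
        (B.isBoundedBilinearMap.contDiff.comp (ha.prodMk hb)).of_le (by exact_mod_cast le_top)
      rw [e1, fun_iteratedFDeriv_add
        (hsm _ ((hf' (hw ε)).sub (hf' (hw' ε))) (hg' (hw ε)))
        (hsm _ (hf' (hw' ε)) (hg' ((hw ε).sub (hw' ε))))]

end Superposition

section Algebra

variable (E : Type*) [NormedAddCommGroup E] [NormedSpace ℝ E] (𝕜 : Type u) [RCLike 𝕜]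

/-- The algebra of moderate families on `E` with values in `𝕜`. -/
def moderate : Subalgebra 𝕜 (Eps → E → 𝕜) where
  carrier := {w | IsModerate w}
  mul_mem' := fun ha hb => IsModerate.bilin (ContinuousLinearMap.mul ℝ 𝕜) ha hb
  add_mem' := fun ha hb => IsModerate.add ha hb
  algebraMap_mem' := fun c => IsModerate.const c

/-- The ideal of null families in the algebra of moderate families. -/
def nullIdeal : Ideal (moderate E 𝕜) where
  carrier := {w | IsNull w.1}
  zero_mem' := IsNull.zero
  add_mem' := fun ha hb => IsNull.add ha hb
  smul_mem' := fun c _ hx => IsNull.bilin_right (ContinuousLinearMap.mul ℝ 𝕜) c.2 hx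

/-- The (special) Colombeau algebra `𝒢(E)`: moderate families modulo null families. -/
abbrev GenFun : Type _ := moderate E 𝕜 ⧸ nullIdeal E 𝕜

variable {E 𝕜}

/-- The class in `𝒢(E)` of a moderate family. -/
def mk (w : Eps → E → 𝕜) (hw : IsModerate w) : GenFun E 𝕜 :=
  Ideal.Quotient.mk (nullIdeal E 𝕜) ⟨w, hw⟩

lemma mk_eq_mk {w w' : Eps → E → 𝕜} (hw : IsModerate w) (hw' : IsModerate w') :
    mk w hw = mk w' hw' ↔ IsNull (fun ε x => w ε x - w' ε x) :=
  Ideal.Quotient.eq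

lemma isNull_sub_of_rel {a b : moderate E 𝕜}
    (h : (nullIdeal E 𝕜).quotientRel a b) : IsNull (fun ε x => a.1 ε x - b.1 ε x) :=
  (Submodule.quotientRel_def (nullIdeal E 𝕜)).1 h

/-- Directional (in particular partial) derivatives on `𝒢(E)`, defined on representatives. -/
def GenFun.dirDeriv (v : E) (U : GenFun E 𝕜) : GenFun E 𝕜 :=
  Quotient.liftOn U
    (fun w : moderate E 𝕜 => mk (fun ε => Colombeau.dirDeriv v (w.1 ε)) (IsModerate.dirDeriv v w.2))
    fun a b h => (mk_eq_mk _ _).2 <| by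
      have h1 := IsNull.dirDeriv v (isNull_sub_of_rel h)
      convert h1 using 3 with ε x
      simp only [Colombeau.dirDeriv]
      rw [fderiv_fun_sub ((a.2.1 ε).differentiable (by simp) x)
        ((b.2.1 ε).differentiable (by simp) x)]
      simp

/-- Pull-back along a linear map, defined on representatives. -/
def GenFun.pullback {E' : Type*} [NormedAddCommGroup E'] [NormedSpace ℝ E'] (L : E' →L[ℝ] E)
    (U : GenFun E 𝕜) : GenFun E' 𝕜 :=
  Quotient.liftOn U
    (fun w : moderate E 𝕜 => mk (fun ε y => w.1 ε (L y)) (IsModerate.pullback L w.2))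
    fun _ _ h => (mk_eq_mk _ _).2 <| IsNull.pullback L (isNull_sub_of_rel h)

/-- The superposition `f(U)` for smooth `f` of at most polynomial growth together with all its
derivatives, defined on representatives. -/
def GenFun.superpos (f : 𝕜 → 𝕜) (hf : f.HasTemperateGrowth) (U : GenFun E 𝕜) : GenFun E 𝕜 :=
  Quotient.liftOn U
    (fun w : moderate E 𝕜 => mk (fun ε x => f (w.1 ε x))
      ⟨fun ε => hf.1.comp (w.2.1 ε), fun K hK k =>
        modOn_superpos w.2.1 (fun j => w.2.2 K hK j) k hf⟩)
    fun a b h => (mk_eq_mk _ _).2 <|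
      ⟨fun ε => (hf.1.comp (a.2.1 ε)).sub (hf.1.comp (b.2.1 ε)), fun K hK k =>
        nullOn_superpos a.2.1 b.2.1 (fun j => a.2.2 K hK j) (fun j => b.2.2 K hK j)
          (fun j => (isNull_sub_of_rel h).2 K hK j) k hf⟩

end Algebra

section Embedding

variable (E : Type u) [NormedAddCommGroup E] [NormedSpace ℝ E] [MeasureSpace E]
variable (𝕜 : Type v) [RCLike 𝕜]

/-- The data entering the embedding of distributions: a rapidly decreasing function `φ` of
integral one all of whose moments of order at least one vanish, and a compactly supported smooth
cut-off `χ` which is identically one near the origin. Monomials of degree `k` are written as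
products of `k` linear forms. -/
structure Mollifier where
  φ : SchwartzMap E 𝕜
  integral_eq_one : ∫ x, φ x = 1
  moments_eq_zero : ∀ k : ℕ, 1 ≤ k → ∀ m : Fin k → (E →L[ℝ] ℝ), ∫ x, (∏ i, m i x) • φ x = 0
  χ : E → 𝕜
  χ_smooth : ContDiff ℝ ∞ χ
  χ_compact : HasCompactSupport χ
  χ_eq_one : ∀ᶠ x in 𝓝 (0 : E), χ x = 1

variable {E 𝕜}

/-- The kernel `χ φ_ε`, where `φ_ε(x) = ε ^ (-n) φ(x / ε)` and `n` is the dimension. -/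
def Mollifier.kernel (ρ : Mollifier E 𝕜) (ε : Eps) (x : E) : 𝕜 :=
  ρ.χ x * (((ε : ℝ) ^ Module.finrank ℝ E)⁻¹ • ρ.φ ((ε : ℝ)⁻¹ • x))

/-- The regularizations `g ∗ (χ φ_ε)` of a function `g`. -/
def Mollifier.regularize (ρ : Mollifier E 𝕜) (g : E → 𝕜) (ε : Eps) : E → 𝕜 :=
  convolution g (ρ.kernel ε) (ContinuousLinearMap.mul ℝ 𝕜) volume

lemma Mollifier.kernel_smooth (ρ : Mollifier E 𝕜) (ε : Eps) : ContDiff ℝ ∞ (ρ.kernel ε) :=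
  ρ.χ_smooth.mul (((ρ.φ.smooth ⊤).comp (contDiff_const_smul _)).const_smul _)

lemma Mollifier.kernel_compact (ρ : Mollifier E 𝕜) (ε : Eps) : HasCompactSupport (ρ.kernel ε) :=
  ρ.χ_compact.mul_right

lemma Mollifier.kernel_modOn (ρ : Mollifier E 𝕜) (k : ℕ) :
    ModOn univ (fun ε => iteratedFDeriv ℝ k (ρ.kernel ε)) := by
  refine modOn_bilin (ContinuousLinearMap.mul ℝ 𝕜) (a := fun _ => ρ.χ)
    (b := fun ε x => ((ε : ℝ) ^ Module.finrank ℝ E)⁻¹ • ρ.φ ((ε : ℝ)⁻¹ • x))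
    (fun _ => ρ.χ_smooth)
    (fun ε => ((ρ.φ.smooth ⊤).comp (contDiff_const_smul _)).const_smul _) k
    (fun i _ => ?_) fun i _ => ?_
  · obtain ⟨C, hC⟩ := (ρ.χ_compact.iteratedFDeriv (𝕜 := ℝ) i).exists_bound_of_continuous
      (ρ.χ_smooth.continuous_iteratedFDeriv (m := i) (by exact_mod_cast le_top))
    exact (ModOn.const univ C).of_le fun ε x _ => (hC x).trans (Real.le_norm_self _)
  · obtain ⟨C, hC⟩ := ρ.φ.decay 0 i
    refine ⟨Module.finrank ℝ E + i, C, Eventually.of_forall fun ε x _ => ?_⟩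
    have h0 : (0 : ℝ) < ε := ε.2.1
    have hs : ContDiff ℝ i ρ.φ := ρ.φ.smooth i
    have hs' : ContDiff ℝ i (fun x : E => ρ.φ ((ε : ℝ)⁻¹ • x)) :=
      hs.comp (contDiff_const_smul _)
    have e1 : iteratedFDeriv ℝ i
        (fun x => ((ε : ℝ) ^ Module.finrank ℝ E)⁻¹ • ρ.φ ((ε : ℝ)⁻¹ • x)) x =
        ((ε : ℝ) ^ Module.finrank ℝ E)⁻¹ • iteratedFDeriv ℝ i
          (fun x : E => ρ.φ ((ε : ℝ)⁻¹ • x)) x :=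
      iteratedFDeriv_const_smul_apply' hs'.contDiffAt
    beta_reduce
    rw [e1, iteratedFDeriv_comp_const_smul _ hs, norm_smul, norm_smul]
    have h1 := hC.2 ((ε : ℝ)⁻¹ • x)
    rw [pow_zero, one_mul] at h1
    rw [norm_inv, norm_pow, norm_pow, norm_inv, Real.norm_of_nonneg h0.le, zpow_neg,
      zpow_natCast, pow_add, mul_inv, ← inv_pow _ i, mul_comm C, mul_assoc]
    gcongr

variable [BorelSpace E] [FiniteDimensional ℝ E] [(volume : Measure E).IsAddHaarMeasure]

lemma norm_convolution_le {A F G : Type*} [NormedAddCommGroup A] [NormedSpace ℝ A]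
    [NormedAddCommGroup F] [NormedSpace ℝ F] [NormedAddCommGroup G] [NormedSpace ℝ G]
    {g : E → A} (hg : LocallyIntegrable g volume) (L : A →L[ℝ] F →L[ℝ] G) {ψ : E → F}
    (hψ : Continuous ψ) (hc : HasCompactSupport ψ) (x : E) :
    ‖convolution g ψ L volume x‖ ≤ ‖L‖ * ∫ t, ‖g t‖ * ‖ψ (x - t)‖ := by
  have hgn : LocallyIntegrable (fun t => ‖g t‖) volume := fun y => (hg y).norm
  have hint : Integrable (fun t => ‖g t‖ * ‖ψ (x - t)‖) volume := by
    have := (hc.norm.convolutionExists_right (ContinuousLinearMap.mul ℝ ℝ) hgn hψ.norm) x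
    simpa [ConvolutionExistsAt] using this
  rw [← integral_const_mul]
  refine norm_integral_le_of_norm_le (hint.const_mul _) (Eventually.of_forall fun t => ?_)
  rw [← mul_assoc]
  exact L.le_opNorm₂ _ _

lemma fderiv_convolution {A F G : Type*} [NormedAddCommGroup A] [NormedSpace ℝ A]
    [NormedAddCommGroup F] [NormedSpace ℝ F] [NormedAddCommGroup G] [NormedSpace ℝ G]
    {g : E → A} (hg : LocallyIntegrable g volume) (L : A →L[ℝ] F →L[ℝ] G) {ψ : E → F}
    (hψ : ContDiff ℝ ∞ ψ) (hc : HasCompactSupport ψ) :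
    fderiv ℝ (convolution g ψ L volume) =
      convolution g (fderiv ℝ ψ) (L.precompR E) volume := by
  funext y
  exact (hc.hasFDerivAt_convolution_right L hg (hψ.of_le (by exact_mod_cast le_top)) y).fderiv

lemma norm_iteratedFDeriv_convolution_aux {A : Type*} [NormedAddCommGroup A] [NormedSpace ℝ A]
    {g : E → A} (hg : LocallyIntegrable g volume) (k : ℕ) :
    ∀ {F G : Type (max u v)} [NormedAddCommGroup F] [NormedSpace ℝ F]
      [NormedAddCommGroup G] [NormedSpace ℝ G] (L : A →L[ℝ] F →L[ℝ] G) {ψ : E → F},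
      ContDiff ℝ ∞ ψ → HasCompactSupport ψ → ∀ x : E,
      ‖iteratedFDeriv ℝ k (convolution g ψ L volume) x‖ ≤
        ‖L‖ * ∫ t, ‖g t‖ * ‖iteratedFDeriv ℝ k ψ (x - t)‖ := by
  induction k with
  | zero =>
    intro F G _ _ _ _ L ψ hψ hc x
    simpa only [norm_iteratedFDeriv_zero] using norm_convolution_le hg L hψ.continuous hc x
  | succ k ih =>
    intro F G _ _ _ _ L ψ hψ hc x
    rw [← norm_iteratedFDeriv_fderiv, fderiv_convolution hg L hψ hc]
    refine (ih (L.precompR E) (hψ.fderiv_right (m := ∞) (by simp)) (hc.fderiv (𝕜 := ℝ)) x).trans ?_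
    simp only [norm_iteratedFDeriv_fderiv]
    exact mul_le_mul_of_nonneg_right (ContinuousLinearMap.norm_precompR_le E L)
      (integral_nonneg fun t => by positivity)

lemma norm_iteratedFDeriv_convolution_le {g : E → 𝕜} (hg : LocallyIntegrable g volume) (k : ℕ)
    {ψ : E → 𝕜} (hψ : ContDiff ℝ ∞ ψ) (hc : HasCompactSupport ψ) (x : E) :
    ‖iteratedFDeriv ℝ k (convolution g ψ (ContinuousLinearMap.mul ℝ 𝕜) volume) x‖ ≤
      ‖ContinuousLinearMap.mul ℝ 𝕜‖ * ∫ t, ‖g t‖ * ‖iteratedFDeriv ℝ k ψ (x - t)‖ := by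
  rcases k with _ | k
  · simpa only [norm_iteratedFDeriv_zero] using norm_convolution_le hg _ hψ.continuous hc x
  · rw [← norm_iteratedFDeriv_fderiv, fderiv_convolution hg _ hψ hc]
    refine (norm_iteratedFDeriv_convolution_aux.{u, v} hg k
      ((ContinuousLinearMap.mul ℝ 𝕜).precompR E) (hψ.fderiv_right (m := ∞) (by simp))
      (hc.fderiv (𝕜 := ℝ)) x).trans ?_
    simp only [norm_iteratedFDeriv_fderiv]
    exact mul_le_mul_of_nonneg_right (ContinuousLinearMap.norm_precompR_le E _)
      (integral_nonneg fun t => by positivity)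

lemma Mollifier.isModerate_regularize (ρ : Mollifier E 𝕜) {g : E → 𝕜}
    (hg : LocallyIntegrable g volume) : IsModerate (ρ.regularize g) := by
  refine ⟨fun ε => (ρ.kernel_compact ε).contDiff_convolution_right (n := ⊤) _ hg
    (ρ.kernel_smooth ε), fun K hK k => ?_⟩
  obtain ⟨p, C, hC⟩ := ρ.kernel_modOn k
  set S : Set E := (fun z : E × E => z.1 - z.2) '' (K ×ˢ tsupport ρ.χ) with hS
  have hSc : IsCompact S := (hK.prod ρ.χ_compact).image (continuous_fst.sub continuous_snd)
  have hgS : IntegrableOn (fun t => ‖g t‖) S volume := (hg.integrableOn_isCompact hSc).norm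
  refine ⟨p, ‖ContinuousLinearMap.mul ℝ 𝕜‖ * ((∫ t in S, ‖g t‖) * C), ?_⟩
  filter_upwards [hC] with ε hε x hx
  refine (norm_iteratedFDeriv_convolution_le hg k (ρ.kernel_smooth ε) (ρ.kernel_compact ε) x).trans ?_
  rw [mul_assoc, mul_assoc]
  refine mul_le_mul_of_nonneg_left ?_ (ContinuousLinearMap.opNorm_nonneg _)
  rw [← integral_mul_const, ← integral_indicator hSc.measurableSet]
  refine integral_mono_of_nonneg (Eventually.of_forall fun t => by positivity)
    ((integrable_indicator_iff hSc.measurableSet).2 (hgS.mul_const _))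
    (Eventually.of_forall fun t => ?_)
  by_cases ht : t ∈ S
  · simp only [indicator_of_mem ht]
    exact mul_le_mul_of_nonneg_left (hε _ (mem_univ _)) (norm_nonneg _)
  · simp only [indicator_of_notMem ht]
    have h1 : x - t ∉ tsupport (iteratedFDeriv ℝ k (ρ.kernel ε)) := fun h => by
      refine ht ⟨(x, x - t), ⟨hx, ?_⟩, by simp⟩
      exact (tsupport_mul_subset_left (f := ρ.χ)) (tsupport_iteratedFDeriv_subset k h)
    rw [image_eq_zero_of_notMem_tsupport h1]
    simp

/-- The embedding `ι` of distributions into `𝒢(E)`, on the regular distributions given by locally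
integrable functions: `ι(g)` is the class of `g ∗ (χ φ_ε)`. -/
def embed (ρ : Mollifier E 𝕜) (g : E → 𝕜) (hg : LocallyIntegrable g volume) : GenFun E 𝕜 :=
  mk (ρ.regularize g) (ρ.isModerate_regularize hg)

end Embedding

section Wave

variable {𝕜 : Type u} [RCLike 𝕜]

/-- The direction of `∂_x` for functions of `(x, t)`. -/
abbrev dx : ℝ × ℝ := (1, 0)

/-- The direction of `∂_t` for functions of `(x, t)`. -/
abbrev dt : ℝ × ℝ := (0, 1)

/-- `w ∈ C²(ℝ²)` is a classical solution of `∂_t² w - ∂_x² w = f(w) + h` with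
`w(x,0) = a(x)`, `∂_t w(x,0) = b(x)`. -/
structure IsClassicalSolution (f : 𝕜 → 𝕜) (a b : ℝ → 𝕜) (h : ℝ × ℝ → 𝕜) (w : ℝ × ℝ → 𝕜) :
    Prop where
  contDiff : ContDiff ℝ 2 w
  wave : ∀ x t : ℝ, dirDeriv dt (dirDeriv dt w) (x, t) - dirDeriv dx (dirDeriv dx w) (x, t) =
    f (w (x, t)) + h (x, t)
  initial : ∀ x : ℝ, w (x, 0) = a x
  initial_dt : ∀ x : ℝ, dirDeriv dt w (x, 0) = b x

/-- The restriction of an element of `𝒢(ℝ²)` to the line `{t = 0}`. -/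
def GenFun.restrict (U : GenFun (ℝ × ℝ) 𝕜) : GenFun ℝ 𝕜 :=
  U.pullback (ContinuousLinearMap.inl ℝ ℝ ℝ)

/-- `U ∈ 𝒢(ℝ²)` solves `∂_t² U - ∂_x² U = f(U) + H` in `𝒢(ℝ²)` with
`U|_{t=0} = A`, `∂_t U|_{t=0} = B` in `𝒢(ℝ)`. -/
structure IsGenSolution (f : 𝕜 → 𝕜) (hf : f.HasTemperateGrowth) (A B : GenFun ℝ 𝕜)
    (H U : GenFun (ℝ × ℝ) 𝕜) : Prop where
  wave : (U.dirDeriv dt).dirDeriv dt - (U.dirDeriv dx).dirDeriv dx = U.superpos f hf + H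
  initial : U.restrict = A
  initial_dt : (U.dirDeriv dt).restrict = B

end Wave

end Colombeau

end

/-! In the characteristic coordinates ξ = x + t, η = x - t the equation reads ∂_η∂_ξ V = -(f(V) +
h)/4, and the Cauchy data prescribe V = a and ∂_ξ V = (a' + b)/2 on the diagonal ξ = η. Integrating
twice gives V = V₀ + `coneIntegral` of (f(V) + h)/4. For the weight exp(l|ξ - η|), each of the two
integrations gains a factor 1/l, so with l = 2L + 1 the integral operator halves weighted distances
on every square [-T, T]². Picard iteration therefore converges on the whole plane
(`exists_eq_add_coneIntegral`). Since the cone integral gains a derivative, the solution is smooth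
(`contDiff_of_eq_add_coneIntegral`).

The same weight yields an a priori bound (`exists_bound_of_wave`): if Cauchy data and defect are at
most δ, a function satisfying the corresponding Lipschitz inequality is at most C δ on a
characteristic diamond, with C depending only on L and T. Taking δ = 0 gives classical uniqueness;
taking δ of size ε^q compares a representative of a generalized solution with w and gives null
estimates of order zero.

Two facts about families finish the proof. A moderate family with null estimates of order zero is
null, because intermediate derivatives are controlled by interpolation (`IsModerate.isNull`). For
smooth g, the family g ∗ (χ φ_ε) - g is null, by Taylor expansion and the vanishing moments
(`Mollifier.isNull_regularize_sub`). Hence all embedded data, and ι(w), may be replaced by constant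
families, for which w solves the equations exactly. -/

noncomputable section

namespace Colombeau

/-! ### Smooth dependence of integrals on parameters. -/

section ParametricIntegrals

variable {E F : Type*} [NormedAddCommGroup E] [NormedSpace ℝ E] [NormedAddCommGroup F]
  [NormedSpace ℝ F]

lemma hasFDerivAt_intervalIntegral_param [ProperSpace E] {H : E × ℝ → F} (hH : ContDiff ℝ 1 H)
    (a b : ℝ) (x : E) :
    HasFDerivAt (fun y => ∫ s in a..b, H (y, s))
      (∫ s in a..b, (fderiv ℝ H (x, s)).comp (ContinuousLinearMap.inl ℝ E ℝ)) x := by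
  have hc : Continuous fun p : E × ℝ =>
      (fderiv ℝ H p).comp (ContinuousLinearMap.inl ℝ E ℝ) :=
    (hH.continuous_fderiv one_ne_zero).clm_comp continuous_const
  obtain ⟨C, hC⟩ := ((isCompact_closedBall x 1).prod (isCompact_uIcc (a := a)
    (b := b))).exists_bound_of_continuousOn hc.continuousOn
  refine intervalIntegral.hasFDerivAt_integral_of_dominated_of_fderiv_le (μ := volume)
    (F := fun y s => H (y, s))
    (F' := fun y s => (fderiv ℝ H (y, s)).comp (ContinuousLinearMap.inl ℝ E ℝ))
    (bound := fun _ => C) (Metric.closedBall_mem_nhds x one_pos) ?_ ?_ ?_ ?_ ?_ ?_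
  · exact Eventually.of_forall fun y => Continuous.aestronglyMeasurable (by fun_prop)
  · exact Continuous.intervalIntegrable (by fun_prop) _ _
  · exact Continuous.aestronglyMeasurable (hc.comp (by fun_prop : Continuous fun s => (x, s)))
  · exact Eventually.of_forall fun s hs y hy => hC (y, s) ⟨hy, uIoc_subset_uIcc hs⟩
  · exact intervalIntegrable_const
  · refine Eventually.of_forall fun s _ y _ => ?_
    exact (hH.differentiable one_ne_zero (y, s)).hasFDerivAt.comp y (hasFDerivAt_prodMk_left y s)

/-- Differentiation under the integral sign, iterated. Working with one directional derivative at a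
time keeps the integrand `F`-valued, so the induction hypothesis applies to it directly. -/
lemma contDiff_intervalIntegral_param [FiniteDimensional ℝ E] (a b : ℝ) (n : ℕ) :
    ∀ {H : E × ℝ → F}, ContDiff ℝ n H → ContDiff ℝ n (fun x => ∫ s in a..b, H (x, s)) := by
  have : ProperSpace E := FiniteDimensional.proper ℝ E
  induction n with
  | zero =>
    intro H hH
    rw [Nat.cast_zero, contDiff_zero] at hH ⊢
    exact intervalIntegral.continuous_parametric_intervalIntegral_of_continuous' (by exact hH) a b
  | succ n ih =>
    intro H hH
    push_cast at hH ⊢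
    have h1 : ContDiff ℝ 1 H := hH.of_le le_add_self
    have hd := hasFDerivAt_intervalIntegral_param h1 a b
    refine contDiff_succ_iff_fderiv_apply.2 ⟨fun x => (hd x).differentiableAt, by simp, fun y => ?_⟩
    have e : (fun x => fderiv ℝ (fun x => ∫ s in a..b, H (x, s)) x y) =
        fun x => ∫ s in a..b, fderiv ℝ H (x, s) (y, 0) := by
      funext x
      rw [(hd x).fderiv, ContinuousLinearMap.intervalIntegral_apply]
      · simp
      · refine Continuous.intervalIntegrable ?_ _ _
        exact ((h1.continuous_fderiv one_ne_zero).comp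
          (by fun_prop : Continuous fun s => (x, s))).clm_comp continuous_const
    rw [e]
    exact ih ((hH.fderiv_right le_rfl).clm_apply contDiff_const)

end ParametricIntegrals

/-! ### The double integral over a characteristic triangle: derivatives, regularity, weighted
estimate. -/

section ConeIntegral

variable {F : Type*} [NormedAddCommGroup F] [NormedSpace ℝ F]

/-- The integral of `G` over the triangle cut out by the diagonal and the two characteristics
through `p`, in characteristic coordinates. -/
def coneIntegral (G : ℝ × ℝ → F) (p : ℝ × ℝ) : F :=
  ∫ s in p.2..p.1, ∫ r in p.2..s, G (s, r)

lemma continuous_integral_snd {G : ℝ × ℝ → F} (hG : Continuous G) :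
    Continuous fun p : ℝ × ℝ => ∫ r in (0 : ℝ)..p.2, G (p.1, r) :=
  intervalIntegral.continuous_parametric_primitive_of_continuous (f := fun x r => G (x, r)) hG

lemma continuous_integral_fst {G : ℝ × ℝ → F} (hG : Continuous G) :
    Continuous fun p : ℝ × ℝ => ∫ s in (0 : ℝ)..p.1, G (s, p.2) :=
  (intervalIntegral.continuous_parametric_primitive_of_continuous (f := fun x r => G (r, x))
    (by exact hG.comp continuous_swap)).comp continuous_swap

/-- Both partial derivatives exist by the fundamental theorem of calculus and are jointly
continuous, which implies Fréchet differentiability. -/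
lemma hasFDerivAt_integral_rectangle [CompleteSpace F] {G : ℝ × ℝ → F} (hG : Continuous G)
    (p : ℝ × ℝ) :
    HasFDerivAt (fun p : ℝ × ℝ => ∫ s in (0 : ℝ)..p.1, ∫ r in (0 : ℝ)..p.2, G (s, r))
      ((ContinuousLinearMap.toSpanSingleton ℝ (∫ r in (0 : ℝ)..p.2, G (p.1, r))).coprod
        (ContinuousLinearMap.toSpanSingleton ℝ (∫ s in (0 : ℝ)..p.1, G (s, p.2)))) p := by
  have c1 := continuous_integral_snd hG
  have c2 := continuous_integral_fst hG
  have hcts : ∀ v : F → ℝ →L[ℝ] F, v = ContinuousLinearMap.toSpanSingleton ℝ → Continuous v := by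
    rintro _ rfl
    exact (ContinuousLinearMap.toSpanSingletonCLE (𝕜 := ℝ) (E := F)).continuous
  refine (hasStrictFDerivAt_uncurry_coprod (𝕜 := ℝ) (u := p)
    (f := fun ξ η => ∫ s in (0 : ℝ)..ξ, ∫ r in (0 : ℝ)..η, G (s, r))
    (f₁ := fun ξ η => ContinuousLinearMap.toSpanSingleton ℝ (∫ r in (0 : ℝ)..η, G (ξ, r)))
    (f₂ := fun ξ η => ContinuousLinearMap.toSpanSingleton ℝ (∫ s in (0 : ℝ)..ξ, G (s, η)))
    (Eventually.of_forall fun v => ?_) (Eventually.of_forall fun v => ?_) ?_ ?_).hasFDerivAt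
  · have h : Continuous fun s => ∫ r in (0 : ℝ)..v.2, G (s, r) :=
      c1.comp (by fun_prop : Continuous fun s : ℝ => (s, v.2))
    exact (intervalIntegral.integral_hasDerivAt_right (h.intervalIntegrable _ _)
      (h.stronglyMeasurableAtFilter _ _) h.continuousAt).hasFDerivAt
  · have h : Continuous fun r => ∫ s in (0 : ℝ)..v.1, G (s, r) :=
      c2.comp (by fun_prop : Continuous fun r : ℝ => (v.1, r))
    -- Here the variable is a limit of the inner integral; Fubini makes it a limit of the outer one.
    have e : (fun η => ∫ s in (0 : ℝ)..v.1, ∫ r in (0 : ℝ)..η, G (s, r)) =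
        fun η => ∫ r in (0 : ℝ)..η, ∫ s in (0 : ℝ)..v.1, G (s, r) := by
      funext η
      refine intervalIntegral_intervalIntegral_swap ?_
      exact (hG.continuousOn.integrableOn_compact (isCompact_uIcc.prod isCompact_uIcc)).mono_set
        (prod_mono uIoc_subset_uIcc uIoc_subset_uIcc)
    rw [e]
    exact (intervalIntegral.integral_hasDerivAt_right (h.intervalIntegrable _ _)
      (h.stronglyMeasurableAtFilter _ _) h.continuousAt).hasFDerivAt
  · exact ((hcts _ rfl).comp c1).continuousAt
  · exact ((hcts _ rfl).comp c2).continuousAt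

/-- Moving all lower limits to 0 leaves functions of one endpoint and rectangle integrals at (p.1,
p.2) and (p.2, p.2), each of which can be differentiated. -/
lemma coneIntegral_eq {G : ℝ × ℝ → F} (hG : Continuous G) (p : ℝ × ℝ) :
    coneIntegral G p =
      ((∫ s in (0 : ℝ)..p.1, ∫ r in (0 : ℝ)..s, G (s, r)) -
        ∫ s in (0 : ℝ)..p.2, ∫ r in (0 : ℝ)..s, G (s, r)) -
      ((∫ s in (0 : ℝ)..p.1, ∫ r in (0 : ℝ)..p.2, G (s, r)) -
        ∫ s in (0 : ℝ)..p.2, ∫ r in (0 : ℝ)..p.2, G (s, r)) := by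
  have c1 := continuous_integral_snd hG
  have h1 : Continuous fun s => ∫ r in (0 : ℝ)..s, G (s, r) :=
    c1.comp (by fun_prop : Continuous fun s : ℝ => (s, s))
  have h2 : Continuous fun s => ∫ r in (0 : ℝ)..p.2, G (s, r) :=
    c1.comp (by fun_prop : Continuous fun s : ℝ => (s, p.2))
  rw [intervalIntegral.integral_interval_sub_left (h1.intervalIntegrable _ _)
      (h1.intervalIntegrable _ _),
    intervalIntegral.integral_interval_sub_left (h2.intervalIntegrable _ _)
      (h2.intervalIntegrable _ _),
    ← intervalIntegral.integral_sub (h1.intervalIntegrable _ _) (h2.intervalIntegrable _ _)]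
  refine intervalIntegral.integral_congr fun s _ => ?_
  have h3 : Continuous fun r => G (s, r) := by fun_prop
  exact (intervalIntegral.integral_interval_sub_left (h3.intervalIntegrable _ _)
    (h3.intervalIntegrable _ _)).symm

/-- Moving p.1 adds the slice s = p.1. Moving p.2 removes the slice r = p.2; its effect on the outer
limit vanishes because the inner integral at s = p.2 is over an empty interval. -/
lemma hasFDerivAt_coneIntegral [CompleteSpace F] {G : ℝ × ℝ → F} (hG : Continuous G)
    (p : ℝ × ℝ) :
    HasFDerivAt (coneIntegral G)
      ((ContinuousLinearMap.toSpanSingleton ℝ (∫ r in p.2..p.1, G (p.1, r))).coprod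
        (-ContinuousLinearMap.toSpanSingleton ℝ (∫ s in p.2..p.1, G (s, p.2)))) p := by
  have c1 := continuous_integral_snd hG
  have h1 : Continuous fun s => ∫ r in (0 : ℝ)..s, G (s, r) :=
    c1.comp (by fun_prop : Continuous fun s : ℝ => (s, s))
  have d1 : ∀ x, HasFDerivAt (fun x => ∫ s in (0 : ℝ)..x, ∫ r in (0 : ℝ)..s, G (s, r))
      (ContinuousLinearMap.toSpanSingleton ℝ (∫ r in (0 : ℝ)..x, G (x, r))) x := fun x =>
    (intervalIntegral.integral_hasDerivAt_right (h1.intervalIntegrable _ _)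
      (h1.stronglyMeasurableAtFilter _ _) h1.continuousAt).hasFDerivAt
  have d2 := hasFDerivAt_integral_rectangle hG
  have d3 := (d2 (p.2, p.2)).comp p
    ((hasFDerivAt_snd (𝕜 := ℝ) (p := p)).prodMk (hasFDerivAt_snd (𝕜 := ℝ) (p := p)))
  have key := (((d1 p.1).comp p hasFDerivAt_fst).sub ((d1 p.2).comp p hasFDerivAt_snd)).sub
    ((d2 p).sub d3)
  rw [show coneIntegral G = _ from funext (coneIntegral_eq hG)]
  refine key.congr_fderiv ?_
  have e1 : ∀ x : ℝ, Continuous fun r => G (x, r) := fun x => by fun_prop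
  have e2 : ∀ x : ℝ, Continuous fun s => G (s, x) := fun x => by fun_prop
  rw [← intervalIntegral.integral_interval_sub_left ((e1 p.1).intervalIntegrable 0 p.1)
      ((e1 p.1).intervalIntegrable 0 p.2),
    ← intervalIntegral.integral_interval_sub_left ((e2 p.2).intervalIntegrable 0 p.1)
      ((e2 p.2).intervalIntegrable 0 p.2)]
  generalize (∫ r in (0 : ℝ)..p.1, G (p.1, r)) = i1, (∫ r in (0 : ℝ)..p.2, G (p.1, r)) = i2,
    (∫ s in (0 : ℝ)..p.1, G (s, p.2)) = i3, (∫ s in (0 : ℝ)..p.2, G (s, p.2)) = i4,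
    (∫ r in (0 : ℝ)..p.2, G (p.2, r)) = i5
  ext <;> simp
  abel

lemma contDiff_integral_characteristic (n : ℕ) {G : ℝ × ℝ → F} {c : ℝ × ℝ → ℝ → ℝ × ℝ}
    (hG : ContDiff ℝ n G) (hc : ContDiff ℝ n (Function.uncurry c)) :
    ContDiff ℝ n (fun p : ℝ × ℝ => ∫ s in p.2..p.1, G (c p s)) := by
  -- An affine substitution makes the limits constant, so that only the integrand depends on the
  -- parameter.
  have e : (fun p : ℝ × ℝ => ∫ s in p.2..p.1, G (c p s)) = fun p =>
      (p.1 - p.2) • ∫ s in (0 : ℝ)..1, G (c p (p.2 + (p.1 - p.2) * s)) := by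
    funext p
    rw [intervalIntegral.smul_integral_comp_add_mul (fun s => G (c p s))]
    simp
  rw [e]
  refine ContDiff.smul (by fun_prop) (contDiff_intervalIntegral_param 0 1 n
    (H := fun q : (ℝ × ℝ) × ℝ => G (c q.1 (q.1.2 + (q.1.1 - q.1.2) * q.2))) ?_)
  exact hG.comp (hc.comp (by fun_prop : ContDiff ℝ n fun q : (ℝ × ℝ) × ℝ =>
    (q.1, q.1.2 + (q.1.1 - q.1.2) * q.2)))

/-- The gain of one derivative drives the regularity bootstrap: the partial derivatives are single
integrals of `G` along characteristics, as smooth as `G` itself. -/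
lemma contDiff_coneIntegral [CompleteSpace F] (n : ℕ) {G : ℝ × ℝ → F} (hG : ContDiff ℝ n G) :
    ContDiff ℝ (n + 1) (coneIntegral G) := by
  have hd := hasFDerivAt_coneIntegral hG.continuous
  refine contDiff_succ_iff_fderiv_apply.2 ⟨fun p => (hd p).differentiableAt, by simp, fun y => ?_⟩
  have e : (fun p => fderiv ℝ (coneIntegral G) p y) = fun p =>
      y.1 • (∫ r in p.2..p.1, G (p.1, r)) - y.2 • ∫ s in p.2..p.1, G (s, p.2) := by
    funext p
    rw [(hd p).fderiv]
    simp [sub_eq_add_neg]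
  rw [e]
  have h1 := contDiff_integral_characteristic n (c := fun p r => (p.1, r)) hG
    (by unfold Function.uncurry; fun_prop)
  have h2 := contDiff_integral_characteristic n (c := fun p r => (r, p.2)) hG
    (by unfold Function.uncurry; fun_prop)
  exact (h1.const_smul y.1).sub (h2.const_smul y.2)

/-- One integration against the exponential weight gains 1/l. The absolute values cover both
orientations, hence both signs of time. -/
lemma abs_integral_exp_mul_abs_sub_le {l : ℝ} (hl : 0 < l) (a b : ℝ) :
    |∫ s in a..b, Real.exp (l * |s - a|)| ≤ Real.exp (l * |b - a|) / l := by
  have key : ∀ c : ℝ, 0 ≤ c →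
      |∫ s in (0 : ℝ)..c, Real.exp (l * s)| ≤ Real.exp (l * c) / l := by
    intro c hc
    rw [intervalIntegral.integral_comp_mul_left _ hl.ne', mul_zero, integral_exp, Real.exp_zero,
      smul_eq_mul, abs_of_nonneg (by
        have : 1 ≤ Real.exp (l * c) := Real.one_le_exp (by positivity)
        have : 0 ≤ Real.exp (l * c) - 1 := by linarith
        positivity), div_eq_inv_mul]
    gcongr
    linarith
  rcases le_total a b with h | h
  · have e : ∫ s in a..b, Real.exp (l * |s - a|) = ∫ s in (0 : ℝ)..(b - a), Real.exp (l * s) := by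
      rw [← sub_self a, ← intervalIntegral.integral_comp_sub_right (fun s => Real.exp (l * s)) a]
      refine intervalIntegral.integral_congr fun s hs => ?_
      rw [uIcc_of_le h] at hs
      simp [abs_of_nonneg (sub_nonneg.2 hs.1)]
    rw [e, abs_of_nonneg (sub_nonneg.2 h)]
    exact key _ (sub_nonneg.2 h)
  · have e : ∫ s in b..a, Real.exp (l * |s - a|) = ∫ s in (0 : ℝ)..(a - b), Real.exp (l * s) := by
      rw [← sub_self a, ← intervalIntegral.integral_comp_sub_left (fun s => Real.exp (l * s)) a]
      refine intervalIntegral.integral_congr fun s hs => ?_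
      rw [uIcc_of_le h] at hs
      simp [abs_of_nonpos (sub_nonpos.2 hs.2)]
    rw [intervalIntegral.integral_symm, abs_neg, e, abs_of_nonpos (sub_nonpos.2 h), neg_sub]
    exact key _ (sub_nonneg.2 h)

/-- Two integrations gain 1/l². The square suffices as domain because it contains the whole triangle
attached to each of its points, so no information from outside enters. -/
lemma norm_coneIntegral_le {l A T : ℝ} (hl : 0 < l) {G : ℝ × ℝ → F}
    (hA : ∀ p ∈ Icc (-T) T ×ˢ Icc (-T) T, ‖G p‖ ≤ A * Real.exp (l * |p.1 - p.2|))
    {p : ℝ × ℝ} (hp : p ∈ Icc (-T) T ×ˢ Icc (-T) T) :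
    ‖coneIntegral G p‖ ≤ A / l ^ 2 * Real.exp (l * |p.1 - p.2|) := by
  have hA0 : 0 ≤ A := by
    have := (norm_nonneg _).trans (hA p hp)
    exact nonneg_of_mul_nonneg_left this (Real.exp_pos _)
  have hsub : ∀ {x}, x ∈ uIoc p.2 p.1 → x ∈ Icc (-T) T := fun hx =>
    uIcc_subset_Icc hp.2 hp.1 (uIoc_subset_uIcc hx)
  have hin : ∀ s ∈ uIoc p.2 p.1, ‖∫ r in p.2..s, G (s, r)‖ ≤
      A / l * Real.exp (l * |s - p.2|) := by
    intro s hs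
    have h1 : ‖∫ r in p.2..s, G (s, r)‖ ≤
        |∫ r in p.2..s, A * Real.exp (l * |r - s|)| := by
      refine intervalIntegral.norm_integral_le_abs_of_norm_le ?_ ?_
      · refine (ae_restrict_iff' measurableSet_uIoc).2 (Eventually.of_forall fun r hr => ?_)
        rw [abs_sub_comm]
        exact hA (s, r) ⟨hsub hs, uIcc_subset_Icc hp.2 (hsub hs) (uIoc_subset_uIcc hr)⟩
      · exact Continuous.intervalIntegrable (by fun_prop) _ _
    refine h1.trans ?_
    rw [intervalIntegral.integral_const_mul, abs_mul, abs_of_nonneg hA0,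
      intervalIntegral.integral_symm, abs_neg, div_mul_eq_mul_div, mul_div_assoc,
      abs_sub_comm s p.2]
    exact mul_le_mul_of_nonneg_left (abs_integral_exp_mul_abs_sub_le hl _ _) hA0
  have h2 : ‖coneIntegral G p‖ ≤ |∫ s in p.2..p.1, A / l * Real.exp (l * |s - p.2|)| := by
    refine intervalIntegral.norm_integral_le_abs_of_norm_le ?_ ?_
    · exact (ae_restrict_iff' measurableSet_uIoc).2 (Eventually.of_forall hin)
    · exact Continuous.intervalIntegrable (by fun_prop) _ _
  refine h2.trans ?_
  rw [intervalIntegral.integral_const_mul, abs_mul, abs_of_nonneg (by positivity)]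
  refine (mul_le_mul_of_nonneg_left (abs_integral_exp_mul_abs_sub_le hl _ _)
    (by positivity)).trans_eq ?_
  field_simp

end ConeIntegral

/-! ### The Cauchy problem in characteristic coordinates, with data on the diagonal. -/

section CharacteristicCauchyProblem

variable {F : Type*} [NormedAddCommGroup F] [NormedSpace ℝ F]

lemma abs_sub_le_of_mem_square {T : ℝ} {p : ℝ × ℝ} (hp : p ∈ Icc (-T) T ×ˢ Icc (-T) T) :
    |p.1 - p.2| ≤ 2 * T := by
  obtain ⟨⟨h1, h2⟩, h3, h4⟩ := hp
  rw [abs_le]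
  constructor <;> linarith

lemma mem_square_diag {T : ℝ} {p : ℝ × ℝ} (hp : p ∈ Icc (-T) T ×ˢ Icc (-T) T) {s : ℝ}
    (hs : s ∈ uIcc p.2 p.1) : s ∈ Icc (-T) T :=
  uIcc_subset_Icc hp.2 hp.1 hs

/-- The fundamental theorem of calculus, once in each variable. In this section `dx` and `dt` are
the directions of ξ and η. -/
lemma eq_add_integral_sub_coneIntegral [CompleteSpace F] {D : ℝ × ℝ → F} (hD : ContDiff ℝ 2 D)
    (p : ℝ × ℝ) :
    D p = D (p.2, p.2) + (∫ s in p.2..p.1, dirDeriv dx D (s, s)) -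
      coneIntegral (dirDeriv dt (dirDeriv dx D)) p := by
  have h1 : ContDiff ℝ 1 (dirDeriv dx D) := (hD.fderiv_right (m := 1) (by norm_num)).clm_apply
    contDiff_const
  have h2 : Continuous (dirDeriv dt (dirDeriv dx D)) :=
    (h1.continuous_fderiv one_ne_zero).clm_apply continuous_const
  have d1 : ∀ η s : ℝ, HasDerivAt (fun s => D (s, η)) (dirDeriv dx D (s, η)) s := fun η s => by
    have := (hD.differentiable two_ne_zero (s, η)).hasFDerivAt.comp_hasDerivAt s
      ((hasDerivAt_id s).prodMk (hasDerivAt_const s η))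
    exact this
  have d2 : ∀ ξ r : ℝ, HasDerivAt (fun r => dirDeriv dx D (ξ, r))
      (dirDeriv dt (dirDeriv dx D) (ξ, r)) r := fun ξ r => by
    have := (h1.differentiable one_ne_zero (ξ, r)).hasFDerivAt.comp_hasDerivAt r
      ((hasDerivAt_const r ξ).prodMk (hasDerivAt_id r))
    exact this
  have c1 : ∀ {k : ℝ → ℝ × ℝ}, Continuous k → Continuous fun s => dirDeriv dx D (k s) :=
    fun hk => h1.continuous.comp hk
  have i1 : ∀ s, ∫ r in p.2..s, dirDeriv dt (dirDeriv dx D) (s, r) =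
      dirDeriv dx D (s, s) - dirDeriv dx D (s, p.2) := fun s =>
    intervalIntegral.integral_eq_sub_of_hasDerivAt (fun r _ => d2 s r)
      ((h2.comp (by fun_prop : Continuous fun r => (s, r))).intervalIntegrable _ _)
  have i2 : ∫ s in p.2..p.1, dirDeriv dx D (s, p.2) = D p - D (p.2, p.2) :=
    intervalIntegral.integral_eq_sub_of_hasDerivAt (fun s _ => d1 p.2 s)
      ((c1 (by fun_prop)).intervalIntegrable _ _)
  rw [coneIntegral, intervalIntegral.integral_congr fun s _ => i1 s,
    intervalIntegral.integral_sub ((c1 (by fun_prop)).intervalIntegrable _ _)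
      ((c1 (by fun_prop)).intervalIntegrable _ _), i2]
  abel

/-- A Gronwall-type estimate by absorption. At a maximum point of the weighted norm the
representation formula bounds the maximum `A` by a multiple of δ plus `A / 2`. The constant is
chosen before `D` and δ, which later makes it independent of ε. -/
lemma exists_bound_of_characteristic [CompleteSpace F] {L T : ℝ} (hL : 0 ≤ L) (hT : 0 ≤ T) :
    ∃ C : ℝ, ∀ (D : ℝ × ℝ → F) (δ : ℝ), ContDiff ℝ 2 D → 0 ≤ δ →
      (∀ s ∈ Icc (-T) T, ‖D (s, s)‖ ≤ δ) →
      (∀ s ∈ Icc (-T) T, ‖dirDeriv dx D (s, s)‖ ≤ δ) →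
      (∀ p ∈ Icc (-T) T ×ˢ Icc (-T) T,
        ‖dirDeriv dt (dirDeriv dx D) p‖ ≤ L * ‖D p‖ + δ) →
      ∀ p ∈ Icc (-T) T ×ˢ Icc (-T) T, ‖D p‖ ≤ C * δ := by
  set l : ℝ := 2 * L + 1 with hl
  have hl1 : 1 ≤ l := by linarith
  refine ⟨2 * (2 + 2 * T) * Real.exp (l * (2 * T)), fun D δ hD hδ h0 h1 h2 p hp => ?_⟩
  obtain ⟨q, hq, hmax⟩ := (isCompact_Icc.prod isCompact_Icc).exists_isMaxOn ⟨p, hp⟩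
    (f := fun p => ‖D p‖ * Real.exp (-(l * |p.1 - p.2|)))
    (by have := hD.continuous; fun_prop)
  set A := ‖D q‖ * Real.exp (-(l * |q.1 - q.2|)) with hA
  have hbd : ∀ p ∈ Icc (-T) T ×ˢ Icc (-T) T, ‖D p‖ ≤ A * Real.exp (l * |p.1 - p.2|) := by
    intro p hp
    have h3 : ‖D p‖ * Real.exp (-(l * |p.1 - p.2|)) ≤ A := hmax hp
    rwa [Real.exp_neg, ← div_eq_mul_inv, div_le_iff₀ (Real.exp_pos _)] at h3
  have hA0 : 0 ≤ A := by positivity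
  have hcone := norm_coneIntegral_le (T := T) (A := L * A + δ) (zero_lt_one.trans_le hl1)
    (G := dirDeriv dt (dirDeriv dx D)) (fun p hp => by
      refine (h2 p hp).trans ?_
      rw [add_mul, mul_assoc]
      have : 1 ≤ Real.exp (l * |p.1 - p.2|) := Real.one_le_exp (by positivity)
      exact add_le_add (mul_le_mul_of_nonneg_left (hbd p hp) hL)
        (le_mul_of_one_le_right hδ this)) hq
  have hint : ‖∫ s in q.2..q.1, dirDeriv dx D (s, s)‖ ≤ δ * (2 * T) := by
    refine (intervalIntegral.norm_integral_le_of_norm_le_const fun s hs =>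
      h1 s (mem_square_diag hq (uIoc_subset_uIcc hs))).trans ?_
    exact mul_le_mul_of_nonneg_left (abs_sub_le_of_mem_square hq) hδ
  have hDq : ‖D q‖ ≤ δ + δ * (2 * T) +
      (L * A + δ) / l ^ 2 * Real.exp (l * |q.1 - q.2|) := by
    rw [eq_add_integral_sub_coneIntegral hD q]
    exact (norm_sub_le _ _).trans (add_le_add ((norm_add_le _ _).trans
      (add_le_add (h0 _ hq.2) hint)) hcone)
  -- The choice l = 2L + 1 gives both L / l² ≤ 1/2 and 1 / l² ≤ 1.
  have hdiv : (L * A + δ) / l ^ 2 ≤ A / 2 + δ := by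
    rw [div_le_iff₀ (by positivity)]
    have e1 : 2 * L ≤ l ^ 2 := by nlinarith
    have e2 : 1 ≤ l ^ 2 := one_le_pow₀ hl1
    nlinarith [mul_le_mul_of_nonneg_right e1 hA0, mul_le_mul_of_nonneg_right e2 hδ]
  -- Multiplying by the inverse weight at the maximum point cancels the exponential; solving for `A`
  -- gives A ≤ 2(2 + 2T)δ.
  have hAle : A ≤ δ + δ * (2 * T) + (A / 2 + δ) := by
    have e1 : Real.exp (-(l * |q.1 - q.2|)) ≤ 1 := Real.exp_le_one_iff.2 (by
      have : 0 ≤ l * |q.1 - q.2| := by positivity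
      linarith)
    calc A ≤ (δ + δ * (2 * T) + (L * A + δ) / l ^ 2 * Real.exp (l * |q.1 - q.2|)) *
          Real.exp (-(l * |q.1 - q.2|)) := mul_le_mul_of_nonneg_right hDq (Real.exp_pos _).le
      _ = (δ + δ * (2 * T)) * Real.exp (-(l * |q.1 - q.2|)) + (L * A + δ) / l ^ 2 := by
        rw [add_mul, mul_assoc _ (Real.exp _), ← Real.exp_add]
        simp
      _ ≤ _ := add_le_add (mul_le_of_le_one_right (by positivity) e1) hdiv
  calc ‖D p‖ ≤ A * Real.exp (l * |p.1 - p.2|) := hbd p hp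
    _ ≤ (2 * (2 + 2 * T) * δ) * Real.exp (l * (2 * T)) := by
      refine mul_le_mul (by linarith) ?_ (Real.exp_pos _).le (by positivity)
      gcongr
      exact abs_sub_le_of_mem_square hp
    _ = _ := by ring

lemma continuous_coneIntegral [CompleteSpace F] {G : ℝ × ℝ → F} (hG : Continuous G) :
    Continuous (coneIntegral G) :=
  (show Differentiable ℝ (coneIntegral G) from
    fun p => (hasFDerivAt_coneIntegral hG p).differentiableAt).continuous

lemma coneIntegral_sub {G G' : ℝ × ℝ → F} (hG : Continuous G) (hG' : Continuous G')
    (p : ℝ × ℝ) :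
    coneIntegral G p - coneIntegral G' p = coneIntegral (fun q => G q - G' q) p := by
  have h : ∀ {G : ℝ × ℝ → F}, Continuous G → Continuous fun s => ∫ r in p.2..s, G (s, r) :=
    fun hG => intervalIntegral.continuous_parametric_intervalIntegral_of_continuous
      (f := fun s r => _) (by exact hG) continuous_id
  rw [coneIntegral, coneIntegral, ← intervalIntegral.integral_sub ((h hG).intervalIntegrable _ _)
    ((h hG').intervalIntegrable _ _)]
  refine intervalIntegral.integral_congr fun s _ => ?_
  exact (intervalIntegral.integral_sub (Continuous.intervalIntegrable (by fun_prop) _ _)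
    (Continuous.intervalIntegrable (by fun_prop) _ _)).symm

/-- Picard iteration. The weighted contraction factor 1/2 is the same on all squares, so the global
Lipschitz bound yields a solution on the whole plane without any continuation argument. -/
lemma exists_eq_add_coneIntegral [CompleteSpace F] {L : ℝ} (hL : 0 ≤ L) {V₀ : ℝ × ℝ → F}
    (hV₀ : Continuous V₀) {Ψ : ℝ × ℝ → F → F} (hΨ : Continuous (Function.uncurry Ψ))
    (hlip : ∀ p v v', ‖Ψ p v - Ψ p v'‖ ≤ L * ‖v - v'‖) :
    ∃ V : ℝ × ℝ → F, Continuous V ∧ ∀ p, V p = V₀ p + coneIntegral (fun q => Ψ q (V q)) p := by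
  set l : ℝ := 2 * L + 1 with hl
  have hl1 : 1 ≤ l := by linarith
  have hl0 : 0 < l := by linarith
  have hLl : L / l ^ 2 ≤ 1 / 2 := by
    rw [div_le_iff₀ (by positivity)]
    nlinarith
  have hΨc : ∀ {W : ℝ × ℝ → F}, Continuous W → Continuous fun q => Ψ q (W q) := fun hW =>
    hΨ.comp (continuous_id.prodMk hW)
  have step : ∀ {W W' : ℝ × ℝ → F} {T A : ℝ}, Continuous W → Continuous W' →
      (∀ p ∈ Icc (-T) T ×ˢ Icc (-T) T, ‖W p - W' p‖ ≤ A * Real.exp (l * |p.1 - p.2|)) →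
      ∀ p ∈ Icc (-T) T ×ˢ Icc (-T) T,
        ‖coneIntegral (fun q => Ψ q (W q)) p - coneIntegral (fun q => Ψ q (W' q)) p‖ ≤
          A * (1 / 2) * Real.exp (l * |p.1 - p.2|) := by
    intro W W' T A hW hW' hA p hp
    have hA0 : 0 ≤ A := nonneg_of_mul_nonneg_left ((norm_nonneg _).trans (hA p hp))
      (Real.exp_pos _)
    rw [coneIntegral_sub (hΨc hW) (hΨc hW')]
    refine (norm_coneIntegral_le (A := L * A) hl0 (fun q hq => (hlip _ _ _).trans ?_) hp).trans ?_
    · rw [mul_assoc]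
      exact mul_le_mul_of_nonneg_left (hA q hq) hL
    · rw [mul_comm L, mul_div_assoc]
      gcongr
  let V : ℕ → ℝ × ℝ → F := fun n =>
    Nat.rec V₀ (fun _ W p => V₀ p + coneIntegral (fun q => Ψ q (W q)) p) n
  have hVs : ∀ n p, V (n + 1) p = V₀ p + coneIntegral (fun q => Ψ q (V n q)) p :=
    fun _ _ => rfl
  have hVc : ∀ n, Continuous (V n) := by
    intro n
    induction n with
    | zero => exact hV₀
    | succ n ih => exact hV₀.add (continuous_coneIntegral (hΨc ih))
  have hgeo : ∀ T : ℝ, ∃ M : ℝ, ∀ p ∈ Icc (-T) T ×ˢ Icc (-T) T, ∀ n,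
      dist (V n p) (V (n + 1) p) ≤ M * (1 / 2) ^ n := by
    intro T
    obtain ⟨M, hM⟩ := (isCompact_Icc.prod isCompact_Icc).exists_bound_of_continuousOn
      (s := Icc (-T) T ×ˢ Icc (-T) T) ((hVc 1).sub (hVc 0)).continuousOn
    have h1 : ∀ n, ∀ p ∈ Icc (-T) T ×ˢ Icc (-T) T,
        ‖V (n + 1) p - V n p‖ ≤ M * (1 / 2) ^ n * Real.exp (l * |p.1 - p.2|) := by
      intro n
      induction n with
      | zero =>
        intro p hp
        have : 1 ≤ Real.exp (l * |p.1 - p.2|) := Real.one_le_exp (by positivity)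
        have h0 := hM p hp
        rw [pow_zero, mul_one]
        exact h0.trans (le_mul_of_one_le_right ((norm_nonneg _).trans h0) this)
      | succ n ih =>
        intro p hp
        rw [hVs (n + 1), hVs n, add_sub_add_left_eq_sub, pow_succ, ← mul_assoc]
        exact step (hVc (n + 1)) (hVc n) ih p hp
    refine ⟨M * Real.exp (l * (2 * T)), fun p hp n => ?_⟩
    have hM0 : 0 ≤ M := (norm_nonneg _).trans (hM p hp)
    rw [dist_comm, dist_eq_norm]
    refine (h1 n p hp).trans ?_
    rw [mul_right_comm]
    gcongr
    exact abs_sub_le_of_mem_square hp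
  -- The margin 1 makes the square a neighbourhood of `p`, so estimates on squares give locally
  -- uniform convergence.
  have hmem : ∀ p : ℝ × ℝ, Icc (-(‖p‖ + 1)) (‖p‖ + 1) ×ˢ Icc (-(‖p‖ + 1)) (‖p‖ + 1) ∈ 𝓝 p := by
    intro p
    have h1 := abs_le.1 (norm_fst_le p)
    have h2 := abs_le.1 (norm_snd_le p)
    exact prod_mem_nhds (Icc_mem_nhds (by linarith) (by linarith))
      (Icc_mem_nhds (by linarith) (by linarith))
  have hlim : ∀ p, ∃ v, Tendsto (fun n => V n p) atTop (𝓝 v) := by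
    intro p
    obtain ⟨M, hM⟩ := hgeo (‖p‖ + 1)
    exact cauchySeq_tendsto_of_complete
      (cauchySeq_of_le_geometric _ _ (by norm_num) (hM p (mem_of_mem_nhds (hmem p))))
  choose W hW using hlim
  have hrate : ∀ T : ℝ, ∃ M : ℝ, ∀ p ∈ Icc (-T) T ×ˢ Icc (-T) T, ∀ n,
      ‖V n p - W p‖ ≤ M * (1 / 2) ^ n := by
    intro T
    obtain ⟨M, hM⟩ := hgeo T
    refine ⟨2 * M, fun p hp n => ?_⟩
    have := dist_le_of_le_geometric_of_tendsto _ _ (by norm_num) (hM p hp) (hW p) n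
    rw [dist_eq_norm] at this
    refine this.trans_eq ?_
    ring
  have htend : ∀ M : ℝ, Tendsto (fun n : ℕ => M * (1 / 2 : ℝ) ^ n) atTop (𝓝 0) := fun M => by
    simpa using (tendsto_pow_atTop_nhds_zero_of_lt_one (r := (1 / 2 : ℝ)) (by norm_num)
      (by norm_num)).const_mul M
  have hWc : Continuous W := by
    refine TendstoLocallyUniformly.continuous (F := V) (p := atTop) ?_
      (Frequently.of_forall hVc)
    rw [Metric.tendstoLocallyUniformly_iff]
    intro ε hε p
    obtain ⟨M, hM⟩ := hrate (‖p‖ + 1)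
    refine ⟨_, hmem p, ((htend M).eventually_lt_const hε).mono fun n hn y hy => ?_⟩
    rw [dist_comm, dist_eq_norm]
    exact (hM y hy n).trans_lt hn
  refine ⟨W, hWc, fun p => ?_⟩
  -- The shifted iterates converge to `W p`, and by the contraction estimate also to the right-hand
  -- side.
  refine tendsto_nhds_unique ((tendsto_add_atTop_iff_nat 1).2 (hW p)) ?_
  obtain ⟨M, hM⟩ := hrate (‖p‖ + 1)
  simp only [hVs]
  refine tendsto_const_nhds.add (tendsto_iff_norm_sub_tendsto_zero.2 ?_)
  refine squeeze_zero (fun _ => norm_nonneg _) (fun n => step (A := M * (1 / 2) ^ n) (hVc n) hWc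
    (fun q hq => ?_) p (mem_of_mem_nhds (hmem p))) (by
      simpa only [zero_mul] using ((htend M).mul_const (1 / 2)).mul_const (Real.exp (l * |p.1 - p.2|)))
  have h0 := hM q hq n
  exact h0.trans (le_mul_of_one_le_right ((norm_nonneg _).trans h0)
    (Real.one_le_exp (by positivity)))

/-- Bootstrap: if `V` is of class C^n then so is q ↦ Ψ q (V q), and its cone integral, hence `V`, is
of class C^(n+1). -/
lemma contDiff_of_eq_add_coneIntegral [CompleteSpace F] {V V₀ : ℝ × ℝ → F}
    (hV₀ : ContDiff ℝ ∞ V₀) {Ψ : ℝ × ℝ → F → F} (hΨ : ContDiff ℝ ∞ (Function.uncurry Ψ))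
    (hV : Continuous V) (h : ∀ p, V p = V₀ p + coneIntegral (fun q => Ψ q (V q)) p) :
    ContDiff ℝ ∞ V := by
  refine contDiff_infty.2 fun n => ?_
  induction n with
  | zero => exact contDiff_zero.2 hV
  | succ n ih =>
    rw [funext h]
    push_cast
    refine (hV₀.of_le (by exact_mod_cast le_top)).add (contDiff_coneIntegral n ?_)
    exact (hΨ.of_le (by exact_mod_cast le_top)).comp (contDiff_id.prodMk ih)

lemma exists_characteristic_solution [CompleteSpace F] {L : ℝ} (hL : 0 ≤ L)
    {c g : ℝ → F} (hc : ContDiff ℝ ∞ c) (hg : ContDiff ℝ ∞ g)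
    {Ψ : ℝ × ℝ → F → F} (hΨ : ContDiff ℝ ∞ (Function.uncurry Ψ))
    (hlip : ∀ p v v', ‖Ψ p v - Ψ p v'‖ ≤ L * ‖v - v'‖) :
    ∃ V : ℝ × ℝ → F, ContDiff ℝ ∞ V ∧ (∀ s, V (s, s) = c s) ∧
      (∀ s, dirDeriv dx V (s, s) = g s) ∧
      ∀ p, dirDeriv dt (dirDeriv dx V) p = -Ψ p (V p) := by
  -- `V₀` solves the homogeneous equation with the given data; the cone integral and its
  -- ξ-derivative vanish on the diagonal.
  set V₀ : ℝ × ℝ → F := fun p => c p.2 + ∫ s in p.2..p.1, g s with hV₀def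
  have hV₀ : ContDiff ℝ ∞ V₀ := by
    refine (hc.comp contDiff_snd).add (contDiff_infty.2 fun n => ?_)
    refine contDiff_integral_characteristic n (G := fun q => g q.1) (c := fun _ s => (s, 0)) ?_
      (by unfold Function.uncurry; fun_prop)
    exact (hg.of_le (by exact_mod_cast le_top)).comp contDiff_fst
  obtain ⟨V, hVc, hV⟩ := exists_eq_add_coneIntegral hL hV₀.continuous hΨ.continuous hlip
  have hVs := contDiff_of_eq_add_coneIntegral hV₀ hΨ hVc hV
  have hGc : Continuous fun q => Ψ q (V q) := hΨ.continuous.comp (continuous_id.prodMk hVc)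
  have hdx : dirDeriv dx V = fun p => g p.1 + ∫ r in p.2..p.1, Ψ (p.1, r) (V (p.1, r)) := by
    funext p
    have d1 : HasFDerivAt V₀ ((fderiv ℝ c p.2).comp (ContinuousLinearMap.snd ℝ ℝ ℝ) +
        (ContinuousLinearMap.toSpanSingleton ℝ (g p.1)).comp (ContinuousLinearMap.fst ℝ ℝ ℝ) -
        (ContinuousLinearMap.toSpanSingleton ℝ (g p.2)).comp (ContinuousLinearMap.snd ℝ ℝ ℝ))
        p := by
      have dg : ∀ x, HasFDerivAt (fun x => ∫ s in (0 : ℝ)..x, g s)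
          (ContinuousLinearMap.toSpanSingleton ℝ (g x)) x := fun x =>
        (intervalIntegral.integral_hasDerivAt_right (hg.continuous.intervalIntegrable _ _)
          (hg.continuous.stronglyMeasurableAtFilter _ _) hg.continuous.continuousAt).hasFDerivAt
      have e : V₀ = fun p => c p.2 + (∫ s in (0 : ℝ)..p.1, g s) - ∫ s in (0 : ℝ)..p.2, g s := by
        funext q
        rw [add_sub_assoc, intervalIntegral.integral_interval_sub_left
          (hg.continuous.intervalIntegrable _ _) (hg.continuous.intervalIntegrable _ _)]
      rw [e]
      exact (((hc.differentiable (by simp) p.2).hasFDerivAt.comp p hasFDerivAt_snd).add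
        ((dg p.1).comp p hasFDerivAt_fst)).sub ((dg p.2).comp p hasFDerivAt_snd)
    have d2 := d1.add (hasFDerivAt_coneIntegral hGc p)
    rw [dirDeriv, show V = V₀ + coneIntegral (fun q => Ψ q (V q)) from funext hV, d2.fderiv]
    simp [← hV]
  refine ⟨V, hVs, fun s => ?_, fun s => ?_, fun p => ?_⟩
  · rw [hV]
    simp [hV₀def, coneIntegral]
  · rw [hdx]
    simp
  · have hsm : ContDiff ℝ ∞ (dirDeriv dx V) := contDiff_dirDeriv dx hVs
    have h1 : HasDerivAt (fun r => dirDeriv dx V (p.1, r)) (dirDeriv dt (dirDeriv dx V) p) p.2 := by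
      have := (hsm.differentiable (by simp) (p.1, p.2)).hasFDerivAt.comp_hasDerivAt p.2
        ((hasDerivAt_const p.2 p.1).prodMk (hasDerivAt_id p.2))
      exact this
    rw [hdx] at h1
    have h3 : Continuous fun r => Ψ (p.1, r) (V (p.1, r)) :=
      hGc.comp (by fun_prop : Continuous fun r => (p.1, r))
    -- The second variable enters ∂_ξ V only as the lower limit of the integral, whence the minus
    -- sign.
    have h2 : HasDerivAt (fun r => g p.1 + ∫ t in r..p.1, Ψ (p.1, t) (V (p.1, t)))
        (-Ψ (p.1, p.2) (V (p.1, p.2))) p.2 :=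
      (intervalIntegral.integral_hasDerivAt_left (h3.intervalIntegrable _ _)
        (h3.stronglyMeasurableAtFilter _ _) h3.continuousAt).const_add _
    rw [hdx]
    exact h1.unique h2

end CharacteristicCauchyProblem

/-! ### Calculus of directional derivatives. -/

section DirectionalDerivatives

variable {E F : Type*} [NormedAddCommGroup E] [NormedSpace ℝ E] [NormedAddCommGroup F]
  [NormedSpace ℝ F] {g g' : E → F}

lemma contDiff_one_dirDeriv (v : E) (hg : ContDiff ℝ 2 g) : ContDiff ℝ 1 (dirDeriv v g) :=
  (hg.fderiv_right (m := 1) (by norm_num)).clm_apply contDiff_const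

lemma dirDeriv_sub (v : E) (hg : Differentiable ℝ g) (hg' : Differentiable ℝ g') :
    dirDeriv v (fun x => g x - g' x) = fun x => dirDeriv v g x - dirDeriv v g' x := by
  funext x
  simp only [dirDeriv]
  rw [fderiv_fun_sub (hg x) (hg' x), sub_apply]

lemma dirDeriv_dirDeriv_sub (u v : E) (hg : ContDiff ℝ 2 g) (hg' : ContDiff ℝ 2 g') :
    dirDeriv u (dirDeriv v (fun x => g x - g' x)) =
      fun x => dirDeriv u (dirDeriv v g) x - dirDeriv u (dirDeriv v g') x := by
  rw [dirDeriv_sub v (hg.differentiable two_ne_zero) (hg'.differentiable two_ne_zero),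
    dirDeriv_sub u ((contDiff_one_dirDeriv v hg).differentiable one_ne_zero)
      ((contDiff_one_dirDeriv v hg').differentiable one_ne_zero)]

lemma dirDeriv_comp_clm {E' : Type*} [NormedAddCommGroup E'] [NormedSpace ℝ E'] (L : E' →L[ℝ] E)
    (v : E') (hg : Differentiable ℝ g) :
    dirDeriv v (fun y => g (L y)) = fun y => dirDeriv (L v) g (L y) := by
  funext y
  have := ((hg (L y)).hasFDerivAt.comp y L.hasFDerivAt).fderiv
  simp only [dirDeriv]
  rw [show (fun y => g (L y)) = g ∘ L from rfl, this]
  rfl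

lemma dirDeriv_dirDeriv_apply (u v : E) (hg : ContDiff ℝ 2 g) (x : E) :
    dirDeriv u (dirDeriv v g) x = fderiv ℝ (fderiv ℝ g) x u v := by
  have h : DifferentiableAt ℝ (fderiv ℝ g) x :=
    (hg.fderiv_right (m := 1) (by norm_num)).differentiable one_ne_zero x
  have h1 : HasFDerivAt (dirDeriv v g)
      ((ContinuousLinearMap.apply ℝ F v).comp (fderiv ℝ (fderiv ℝ g) x)) x :=
    (ContinuousLinearMap.apply ℝ F v).hasFDerivAt.comp x h.hasFDerivAt
  rw [dirDeriv, h1.fderiv]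
  rfl

end DirectionalDerivatives

/-! ### The classical wave equation: a priori bound, uniqueness, smooth solution. -/

section WaveEquation

variable {F : Type*} [NormedAddCommGroup F] [NormedSpace ℝ F]

/-- The characteristic coordinates `(x + t, x - t)` of `(x, t)`. -/
def toChar : ℝ × ℝ →L[ℝ] ℝ × ℝ :=
  (ContinuousLinearMap.fst ℝ ℝ ℝ + ContinuousLinearMap.snd ℝ ℝ ℝ).prod
    (ContinuousLinearMap.fst ℝ ℝ ℝ - ContinuousLinearMap.snd ℝ ℝ ℝ)

/-- The point `(x, t)` with given characteristic coordinates. -/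
def ofChar : ℝ × ℝ →L[ℝ] ℝ × ℝ :=
  ((2 : ℝ)⁻¹ • (ContinuousLinearMap.fst ℝ ℝ ℝ + ContinuousLinearMap.snd ℝ ℝ ℝ)).prod
    ((2 : ℝ)⁻¹ • (ContinuousLinearMap.fst ℝ ℝ ℝ - ContinuousLinearMap.snd ℝ ℝ ℝ))

lemma toChar_apply (p : ℝ × ℝ) : toChar p = (p.1 + p.2, p.1 - p.2) := rfl

lemma ofChar_apply (q : ℝ × ℝ) : ofChar q = (2⁻¹ * (q.1 + q.2), 2⁻¹ * (q.1 - q.2)) := rfl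

lemma ofChar_toChar (p : ℝ × ℝ) : ofChar (toChar p) = p := by
  ext <;> simp only [toChar_apply, ofChar_apply] <;> ring

lemma toChar_ofChar (q : ℝ × ℝ) : toChar (ofChar q) = q := by
  ext <;> simp only [toChar_apply, ofChar_apply] <;> ring

lemma ofChar_diag (s : ℝ) : ofChar (s, s) = (s, 0) := by
  ext <;> simp [ofChar_apply]; ring

lemma ofChar_dx : ofChar dx = (2 : ℝ)⁻¹ • dx + (2 : ℝ)⁻¹ • dt := by
  ext <;> simp [ofChar_apply]

lemma ofChar_dt : ofChar dt = (2 : ℝ)⁻¹ • dx - (2 : ℝ)⁻¹ • dt := by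
  ext <;> simp [ofChar_apply]

lemma dirDeriv_dx_ofChar {w : ℝ × ℝ → F} (hw : Differentiable ℝ w) (q : ℝ × ℝ) :
    dirDeriv dx (fun q => w (ofChar q)) q =
      (2 : ℝ)⁻¹ • (dirDeriv dx w (ofChar q) + dirDeriv dt w (ofChar q)) := by
  rw [dirDeriv_comp_clm _ _ hw, ofChar_dx]
  simp only [dirDeriv, map_add, map_smul, smul_add]

/-- This is the factorization ∂_η∂_ξ = (∂_x - ∂_t)(∂_x + ∂_t)/4; the mixed terms cancel by symmetry
of the second derivative. -/
lemma dirDeriv_dt_dx_ofChar {w : ℝ × ℝ → F} (hw : ContDiff ℝ 2 w) (q : ℝ × ℝ) :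
    dirDeriv dt (dirDeriv dx (fun q => w (ofChar q))) q =
      -((4 : ℝ)⁻¹ • (dirDeriv dt (dirDeriv dt w) (ofChar q) -
        dirDeriv dx (dirDeriv dx w) (ofChar q))) := by
  have hsymm : fderiv ℝ (fderiv ℝ w) (ofChar q) dx dt = fderiv ℝ (fderiv ℝ w) (ofChar q) dt dx :=
    (hw.contDiffAt.isSymmSndFDerivAt (by simp)).eq _ _
  rw [dirDeriv_comp_clm _ _ (hw.differentiable two_ne_zero), dirDeriv_comp_clm _ _
    ((contDiff_one_dirDeriv _ hw).differentiable one_ne_zero)]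
  simp only [dirDeriv_dirDeriv_apply _ _ hw]
  rw [ofChar_dx, ofChar_dt]
  simp only [map_sub, map_add, map_smul, sub_apply,
    smul_apply, hsymm]
  module

/-- The image in the `(x, t)`-plane of a square in characteristic coordinates; it is a union of
two characteristic triangles over `[-T, T]`. -/
def diamond (T : ℝ) : Set (ℝ × ℝ) := ofChar '' (Icc (-T) T ×ˢ Icc (-T) T)

lemma isCompact_diamond (T : ℝ) : IsCompact (diamond T) :=
  (isCompact_Icc.prod isCompact_Icc).image ofChar.continuous

lemma exists_subset_diamond {K : Set (ℝ × ℝ)} (hK : IsCompact K) :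
    ∃ T : ℝ, 0 ≤ T ∧ K ⊆ diamond T := by
  obtain ⟨C, hC⟩ := hK.exists_bound_of_continuousOn toChar.continuous.continuousOn
  refine ⟨max C 0, le_max_right _ _, fun p hp => ⟨toChar p, ?_, ofChar_toChar p⟩⟩
  have h := (hC p hp).trans (le_max_left C 0)
  exact ⟨abs_le.1 ((norm_fst_le _).trans h), abs_le.1 ((norm_snd_le _).trans h)⟩

/-- The characteristic bound transported by `ofChar`. The factors 1/2 and 1/4 from the change of
variables only help, so δ and `L` are kept. -/
lemma exists_bound_of_wave [CompleteSpace F] {L T : ℝ} (hL : 0 ≤ L) (hT : 0 ≤ T) :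
    ∃ C : ℝ, ∀ (d : ℝ × ℝ → F) (δ : ℝ), ContDiff ℝ 2 d → 0 ≤ δ →
      (∀ s ∈ Icc (-T) T, ‖d (s, 0)‖ ≤ δ) →
      (∀ s ∈ Icc (-T) T, ‖dirDeriv dx d (s, 0)‖ ≤ δ) →
      (∀ s ∈ Icc (-T) T, ‖dirDeriv dt d (s, 0)‖ ≤ δ) →
      (∀ p ∈ diamond T, ‖dirDeriv dt (dirDeriv dt d) p - dirDeriv dx (dirDeriv dx d) p‖ ≤
        L * ‖d p‖ + δ) →
      ∀ p ∈ diamond T, ‖d p‖ ≤ C * δ := by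
  obtain ⟨C, hC⟩ := exists_bound_of_characteristic (F := F) hL hT
  refine ⟨C, fun d δ hd hδ h0 hx ht hw => ?_⟩
  rintro _ ⟨q, hq, rfl⟩
  refine hC (fun q => d (ofChar q)) δ (hd.comp ofChar.contDiff) hδ (fun s hs => ?_)
    (fun s hs => ?_) (fun p hp => ?_) q hq
  · rw [ofChar_diag]
    exact h0 s hs
  · rw [dirDeriv_dx_ofChar (hd.differentiable two_ne_zero), ofChar_diag, norm_smul]
    have := norm_add_le_of_le (hx s hs) (ht s hs)
    rw [Real.norm_of_nonneg (by norm_num)]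
    linarith
  · rw [dirDeriv_dt_dx_ofChar hd, norm_neg, norm_smul, Real.norm_of_nonneg (by norm_num)]
    have := hw _ (mem_image_of_mem ofChar hp)
    have h1 : 0 ≤ L * ‖d (ofChar p)‖ + δ := by positivity
    linarith

variable {𝕜 : Type*} [RCLike 𝕜] {f : 𝕜 → 𝕜} {a b : ℝ → 𝕜} {h : ℝ × ℝ → 𝕜}

/-- The a priori bound applied to the difference of two solutions, with δ = 0. -/
lemma IsClassicalSolution.unique {L : NNReal} (hf : LipschitzWith L f) {w w' : ℝ × ℝ → 𝕜}
    (hw : IsClassicalSolution f a b h w) (hw' : IsClassicalSolution f a b h w') : w' = w := by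
  funext p
  obtain ⟨T, hT, hpT⟩ := exists_subset_diamond (isCompact_singleton (x := p))
  obtain ⟨C, hC⟩ := exists_bound_of_wave (F := 𝕜) L.coe_nonneg hT
  have hd := hw.contDiff.differentiable two_ne_zero
  have hd' := hw'.contDiff.differentiable two_ne_zero
  have hzero : (fun x : ℝ => w' (x, 0) - w (x, 0)) = fun _ => 0 := by
    funext x
    rw [hw.initial, hw'.initial, sub_self]
  have key := hC (fun q => w' q - w q) 0 (hw'.contDiff.sub hw.contDiff) le_rfl
    (fun s _ => by rw [hw.initial, hw'.initial]; simp) (fun s _ => ?_) (fun s _ => ?_)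
    (fun q _ => ?_) p (hpT rfl)
  · rw [mul_zero, norm_le_zero_iff, sub_eq_zero] at key
    exact key
  · have e := congrFun (dirDeriv_comp_clm (ContinuousLinearMap.inl ℝ ℝ ℝ) (1 : ℝ)
      (hd'.sub hd)) s
    have e1 : dirDeriv (1 : ℝ) (fun x : ℝ => w' (x, 0) - w (x, 0)) s = 0 := by
      rw [hzero]
      simp [dirDeriv]
    exact (norm_eq_zero.2 (e.symm.trans e1)).le
  · rw [dirDeriv_sub _ hd' hd]
    simp [hw.initial_dt, hw'.initial_dt]
  · rw [dirDeriv_dirDeriv_sub _ _ hw'.contDiff hw.contDiff,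
      dirDeriv_dirDeriv_sub _ _ hw'.contDiff hw.contDiff, add_zero]
    have e : (dirDeriv dt (dirDeriv dt w') q - dirDeriv dt (dirDeriv dt w) q) -
        (dirDeriv dx (dirDeriv dx w') q - dirDeriv dx (dirDeriv dx w) q) =
        f (w' q) - f (w q) := by
      have h1 := hw.wave q.1 q.2
      have h2 := hw'.wave q.1 q.2
      simp only [Prod.mk.eta] at h1 h2
      rw [sub_sub_sub_comm, h1, h2]
      ring
    beta_reduce
    rw [e]
    exact hf.norm_sub_le _ _

lemma exists_smooth_classicalSolution {L : NNReal} (hfs : ContDiff ℝ ∞ f) (hf : LipschitzWith L f)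
    (ha : ContDiff ℝ ∞ a) (hb : ContDiff ℝ ∞ b) (hh : ContDiff ℝ ∞ h) :
    ∃ w : ℝ × ℝ → 𝕜, ContDiff ℝ ∞ w ∧ IsClassicalSolution f a b h w := by
  have ha' : ContDiff ℝ ∞ (deriv a) := (contDiff_infty_iff_deriv.1 ha).2
  -- Since ∂_ξ = (∂_x + ∂_t)/2, the diagonal datum for ∂_ξ V is (a' + b)/2; the source is (f + h)/4,
  -- again Lipschitz with constant `L`.
  obtain ⟨V, hV, hV0, hVx, hVtx⟩ := exists_characteristic_solution (F := 𝕜) L.coe_nonneg ha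
    ((ha'.add hb).const_smul (2 : ℝ)⁻¹)
    (Ψ := fun q v => (4 : ℝ)⁻¹ • (f v + h (ofChar q)))
    (((hfs.comp contDiff_snd).add ((hh.comp ofChar.contDiff).comp contDiff_fst)).const_smul _)
    (fun p v v' => by
      rw [← smul_sub, add_sub_add_right_eq_sub, norm_smul, Real.norm_of_nonneg (by norm_num)]
      have := hf.norm_sub_le v v'
      have := norm_nonneg (f v - f v')
      linarith)
  set w : ℝ × ℝ → 𝕜 := fun p => V (toChar p) with hw
  have hws : ContDiff ℝ ∞ w := hV.comp toChar.contDiff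
  have hwd := hws.differentiable (by simp)
  have hVw : V = fun q => w (ofChar q) := by
    funext q
    rw [hw]
    beta_reduce
    rw [toChar_ofChar]
  have hinit : ∀ x, w (x, 0) = a x := fun x => by
    rw [hw, ← hV0]
    simp [toChar_apply]
  have hwx : ∀ x, dirDeriv dx w (x, 0) = deriv a x := fun x => by
    have e := congrFun (dirDeriv_comp_clm (ContinuousLinearMap.inl ℝ ℝ ℝ) (1 : ℝ) hwd) x
    refine Eq.trans e.symm ?_
    rw [show (fun y : ℝ => w (ContinuousLinearMap.inl ℝ ℝ ℝ y)) = a from funext hinit]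
    rfl
  have hw2 : ContDiff ℝ 2 w := contDiff_infty.1 hws 2
  refine ⟨w, hws, hw2, fun x t => ?_, hinit, fun x => ?_⟩
  · have h1 := hVtx (toChar (x, t))
    rw [hVw, dirDeriv_dt_dx_ofChar hw2, neg_inj] at h1
    simp only [ofChar_toChar] at h1
    exact smul_right_injective 𝕜 (by norm_num : (4 : ℝ)⁻¹ ≠ 0) h1
  -- With ∂_x w = a' known on the initial line, the datum (a' + b)/2 for ∂_ξ V determines ∂_t w = b.
  · have h1 := hVx x
    rw [hVw, dirDeriv_dx_ofChar hwd, ofChar_diag, hwx] at h1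
    exact add_left_cancel (smul_right_injective 𝕜 (by norm_num : (2 : ℝ)⁻¹ ≠ 0) h1)

end WaveEquation

/-! ### Null estimates of order zero suffice for moderate families. -/

section NullCriterion

universe u v

/-- A Landau-type interpolation inequality: by Taylor's formula a difference quotient of step s
differs from the first derivative by at most B s, and costs 2A/s itself. -/
lemma norm_fderiv_le_of_closedBall {E F : Type*} [NormedAddCommGroup E] [NormedSpace ℝ E]
    [NormedAddCommGroup F] [NormedSpace ℝ F] {g : E → F} (hg : ContDiff ℝ 2 g) {x : E}
    {s A B : ℝ} (hs : 0 < s) (hA : ∀ y ∈ Metric.closedBall x s, ‖g y‖ ≤ A)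
    (hB : ∀ y ∈ Metric.closedBall x s, ‖fderiv ℝ (fderiv ℝ g) y‖ ≤ B) :
    ‖fderiv ℝ g x‖ ≤ 2 * A / s + B * s := by
  have hx : x ∈ Metric.closedBall x s := Metric.mem_closedBall_self hs.le
  have hA0 : 0 ≤ A := (norm_nonneg _).trans (hA x hx)
  have hB0 : 0 ≤ B := (norm_nonneg (fderiv ℝ (fderiv ℝ g) x)).trans (hB x hx)
  have hg' : Differentiable ℝ (fderiv ℝ g) :=
    (hg.fderiv_right (m := 1) (by norm_num)).differentiable one_ne_zero
  have h1 : ∀ y ∈ Metric.closedBall x s, ‖fderiv ℝ g y - fderiv ℝ g x‖ ≤ B * s := by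
    intro y hy
    refine ((convex_closedBall x s).norm_image_sub_le_of_norm_fderiv_le (𝕜 := ℝ)
      (fun z _ => hg' z) hB hx hy).trans ?_
    rw [mem_closedBall_iff_norm] at hy
    gcongr
  refine ContinuousLinearMap.opNorm_le_of_unit_norm (by positivity) fun v hv => ?_
  have hy : x + s • v ∈ Metric.closedBall x s := by
    simp [norm_smul, hv, abs_of_pos hs]
  have h2 := (convex_closedBall x s).norm_image_sub_le_of_norm_fderiv_le' (𝕜 := ℝ)
    (fun z _ => hg.differentiable two_ne_zero z) h1 hx hy
  rw [add_sub_cancel_left, norm_smul, hv, mul_one, Real.norm_of_nonneg hs.le, map_smul] at h2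
  have h3 : ‖s • fderiv ℝ g x v‖ ≤ 2 * A + B * s * s := by
    have e : s • fderiv ℝ g x v =
        (g (x + s • v) - g x) - (g (x + s • v) - g x - s • fderiv ℝ g x v) := by abel
    rw [e]
    refine (norm_sub_le _ _).trans (add_le_add ((norm_sub_le _ _).trans ?_) h2)
    linarith [hA _ hy, hA _ hx]
  rw [norm_smul, Real.norm_of_nonneg hs.le] at h3
  have e : 2 * A / s + B * s = (2 * A + B * s * s) / s := by field_simp
  rw [e, le_div_iff₀ hs, mul_comm]
  exact h3

lemma IsModerate.fderiv_family {E F : Type*} [NormedAddCommGroup E] [NormedSpace ℝ E]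
    [NormedAddCommGroup F] [NormedSpace ℝ F] {w : Eps → E → F} (hw : IsModerate w) :
    IsModerate (fun ε => fderiv ℝ (w ε)) := by
  refine ⟨fun ε => (hw.1 ε).fderiv_right (m := ∞) (by simp), fun K hK k => ?_⟩
  exact ModOn.of_le (hw.2 K hK (k + 1)) fun ε x _ => by rw [norm_iteratedFDeriv_fderiv]

lemma IsModerate.nullOn_fderiv {E F : Type*} [NormedAddCommGroup E] [NormedSpace ℝ E]
    [ProperSpace E] [NormedAddCommGroup F] [NormedSpace ℝ F] {w : Eps → E → F}
    (hw : IsModerate w) (h0 : ∀ K, IsCompact K → NullOn K w) {K : Set E} (hK : IsCompact K) :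
    NullOn K (fun ε => fderiv ℝ (w ε)) := by
  intro q
  -- The interpolation balls leave `K`, but their radius ε^(q+p) is at most 1.
  have hK' : IsCompact (Metric.cthickening 1 K) := hK.cthickening
  obtain ⟨p, C, hC⟩ := hw.2 _ hK' 2
  obtain ⟨C', hC'⟩ := h0 _ hK' (2 * q + p)
  refine ⟨2 * C' + C, ?_⟩
  filter_upwards [hC, hC'] with ε h2 h1 x hx
  have hε : (0 : ℝ) < ε := ε.2.1
  have hsub : Metric.closedBall x ((ε : ℝ) ^ (q + p)) ⊆ Metric.cthickening 1 K :=
    (Metric.closedBall_subset_closedBall (pow_le_one₀ hε.le ε.2.2)).trans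
      (Metric.closedBall_subset_cthickening hx 1)
  -- With zeroth order O(ε^(2q+p)) and second order O(ε^(-p)), the step s = ε^(q+p) makes both A/s
  -- and B s of order ε^q.
  have key := norm_fderiv_le_of_closedBall (contDiff_infty.1 (hw.1 ε) 2) (x := x)
    (pow_pos hε (q + p)) (fun y hy => h1 y (hsub hy)) (B := C * (ε : ℝ) ^ (-(p : ℤ)))
    (fun y hy => by
      have := h2 y (hsub hy)
      rwa [← norm_iteratedFDeriv_fderiv, ← norm_iteratedFDeriv_fderiv,
        norm_iteratedFDeriv_zero] at this)
  refine key.trans_eq ?_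
  rw [zpow_neg, zpow_natCast, zpow_natCast, zpow_natCast]
  field_simp
  ring

/-- The induction passes from `F` to `E →L[ℝ] F`, so `F` is quantified inside it and lives in a
universe closed under this passage. -/
lemma nullOn_iteratedFDeriv {E : Type u} [NormedAddCommGroup E] [NormedSpace ℝ E] [ProperSpace E]
    (k : ℕ) : ∀ {F : Type (max u v)} [NormedAddCommGroup F] [NormedSpace ℝ F]
      {w : Eps → E → F}, IsModerate w → (∀ K, IsCompact K → NullOn K w) →
      ∀ K, IsCompact K → NullOn K (fun ε => iteratedFDeriv ℝ k (w ε)) := by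
  induction k with
  | zero => exact fun _ h0 K hK => (h0 K hK).of_le fun ε x _ => by simp
  | succ k ih =>
    intro F _ _ w hw h0 K hK
    refine (ih hw.fderiv_family (fun K' hK' => hw.nullOn_fderiv h0 hK') K hK).of_le fun ε x _ => ?_
    rw [norm_iteratedFDeriv_fderiv]

/-- A moderate family is null as soon as it satisfies the null estimates of order zero. -/
lemma IsModerate.isNull {E : Type u} [NormedAddCommGroup E] [NormedSpace ℝ E] [ProperSpace E]
    {F : Type v} [NormedAddCommGroup F] [NormedSpace ℝ F] {w : Eps → E → F} (hw : IsModerate w)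
    (h0 : ∀ K, IsCompact K → NullOn K w) : IsNull w := by
  refine ⟨hw.1, fun K hK k => ?_⟩
  -- Order zero is treated apart because only the derivative, not `F` itself, has values in the
  -- universe of the preceding induction.
  rcases k with _ | k
  · exact (h0 K hK).of_le fun ε x _ => by simp
  · refine NullOn.of_le (nullOn_iteratedFDeriv.{u, v} k hw.fderiv_family
      (fun K' hK' => hw.nullOn_fderiv h0 hK') K hK) fun ε x _ => ?_
    rw [norm_iteratedFDeriv_fderiv]

lemma IsModerate.const_family {E F : Type*} [NormedAddCommGroup E] [NormedSpace ℝ E]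
    [NormedAddCommGroup F] [NormedSpace ℝ F] {g : E → F} (hg : ContDiff ℝ ∞ g) :
    IsModerate (fun _ => g) := by
  refine ⟨fun _ => hg, fun K hK k => ?_⟩
  obtain ⟨C, hC⟩ := hK.exists_bound_of_continuousOn
    (hg.continuous_iteratedFDeriv (m := k) (by exact_mod_cast le_top)).continuousOn
  exact ⟨0, C, Eventually.of_forall fun ε x hx => by simpa using hC x hx⟩

lemma IsModerate.sub {E F : Type*} [NormedAddCommGroup E] [NormedSpace ℝ E]
    [NormedAddCommGroup F] [NormedSpace ℝ F] {w w' : Eps → E → F} (hw : IsModerate w)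
    (hw' : IsModerate w') : IsModerate (fun ε x => w ε x - w' ε x) := by
  have h : IsModerate (fun ε x => -w' ε x) := by
    refine ⟨fun ε => (hw'.1 ε).neg, fun K hK k => ?_⟩
    refine ModOn.of_le (hw'.2 K hK k) fun ε x _ => ?_
    exact (congrArg norm (iteratedFDeriv_neg_apply (f := w' ε))).trans (norm_neg _) |>.le
  simpa only [sub_eq_add_neg] using hw.add h

lemma IsNull.nullOn {E F : Type*} [NormedAddCommGroup E] [NormedSpace ℝ E]
    [NormedAddCommGroup F] [NormedSpace ℝ F] {w : Eps → E → F} (hw : IsNull w) {K : Set E}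
    (hK : IsCompact K) : NullOn K w :=
  NullOn.of_le (hw.2 K hK 0) fun ε x _ => by simp

end NullCriterion

/-! ### Regularizations of a smooth function differ from it by a null family. -/

section RegularizationOfSmoothFunctions

/-- The cut-off confines `g` to the compact set K - supp χ. The bound thus holds for all z, as
needed to integrate a Taylor remainder over the whole space although `g` may grow arbitrarily fast.
-/
lemma exists_bound_iteratedFDeriv_mul_cutoff {E : Type*} [NormedAddCommGroup E]
    [NormedSpace ℝ E] {𝕜 : Type*} [RCLike 𝕜] {g χ : E → 𝕜} (hg : ContDiff ℝ ∞ g)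
    (hχ : ContDiff ℝ ∞ χ) (hc : HasCompactSupport χ) {K : Set E} (hK : IsCompact K) (k : ℕ) :
    ∃ B : ℝ, ∀ x ∈ K, ∀ z, ‖iteratedFDeriv ℝ k (fun z => g (x - z) * χ z) z‖ ≤ B := by
  set S : Set E := (fun z : E × E => z.1 - z.2) '' (K ×ˢ tsupport χ) with hS
  have hSc : IsCompact S := (hK.prod hc).image (continuous_fst.sub continuous_snd)
  have h1 : ∀ i : ℕ, ∃ C : ℝ, ∀ y ∈ S, ‖iteratedFDeriv ℝ i g y‖ ≤ C := fun i =>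
    hSc.exists_bound_of_continuousOn
      (hg.continuous_iteratedFDeriv (m := i) (by exact_mod_cast le_top)).continuousOn
  have h2 : ∀ i : ℕ, ∃ C : ℝ, ∀ y, ‖iteratedFDeriv ℝ i χ y‖ ≤ C := fun i =>
    (hc.iteratedFDeriv (𝕜 := ℝ) i).exists_bound_of_continuous
      (hχ.continuous_iteratedFDeriv (m := i) (by exact_mod_cast le_top))
  choose C hC using h1
  choose C' hC' using h2
  have hC'0 : ∀ i, 0 ≤ C' i := fun i => (norm_nonneg _).trans (hC' i 0)
  refine ⟨∑ i ∈ Finset.range (k + 1), (k.choose i : ℝ) *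
    (‖-ContinuousLinearMap.id ℝ E‖ ^ i * |C i|) * C' (k - i), fun x hx z => ?_⟩
  by_cases hz : z ∈ tsupport χ
  · have hgx : ContDiff ℝ ∞ fun z => g (x - z) := hg.comp (contDiff_const.sub contDiff_id)
    refine (norm_iteratedFDeriv_mul_le hgx hχ z (by exact_mod_cast le_top)).trans ?_
    refine Finset.sum_le_sum fun i _ => ?_
    have h3 : ‖iteratedFDeriv ℝ i (fun z => g (x - z)) z‖ ≤
        ‖-ContinuousLinearMap.id ℝ E‖ ^ i * |C i| := by
      have h4 := norm_iteratedFDeriv_pullback (-ContinuousLinearMap.id ℝ E)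
        (g := fun y => g (x + y)) (hg.comp (contDiff_const.add contDiff_id)) i z
      rw [iteratedFDeriv_comp_add_left] at h4
      simp only [neg_apply, ContinuousLinearMap.id_apply, ← sub_eq_add_neg]
        at h4
      refine h4.trans (mul_le_mul_of_nonneg_left ?_ (by positivity))
      exact (hC i _ ⟨(x, z), ⟨hx, hz⟩, rfl⟩).trans (le_abs_self _)
    gcongr
    exact hC' _ _
  · have h3 : z ∉ tsupport (iteratedFDeriv ℝ k (fun z => g (x - z) * χ z)) := fun h =>
      hz (tsupport_mul_subset_right (f := fun z => g (x - z)) (tsupport_iteratedFDeriv_subset k h))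
    rw [image_eq_zero_of_notMem_tsupport h3, norm_zero]
    exact Finset.sum_nonneg fun i _ => mul_nonneg (by positivity) (hC'0 _)

variable {E : Type*} [NormedAddCommGroup E] [NormedSpace ℝ E] [MeasureSpace E]
variable {𝕜 : Type*} [RCLike 𝕜]
variable [BorelSpace E] [FiniteDimensional ℝ E] [(volume : Measure E).IsAddHaarMeasure]

lemma Mollifier.integrable_multilinear (ρ : Mollifier E 𝕜) {k : ℕ}
    (M : ContinuousMultilinearMap ℝ (fun _ : Fin k => E) 𝕜) :
    Integrable (fun y => M (fun _ => y) * ρ.φ y) volume := by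
  refine ((ρ.φ.integrable_pow_mul volume k).const_mul ‖M‖).mono' ?_ (Eventually.of_forall ?_)
  · have := ρ.φ.continuous
    exact Continuous.aestronglyMeasurable (by fun_prop)
  · intro y
    rw [norm_mul, ← mul_assoc]
    refine mul_le_mul_of_nonneg_right ((M.le_opNorm _).trans_eq ?_) (norm_nonneg _)
    simp

/-- Expanding y in a basis turns the diagonal of a multilinear map into a combination of products of
linear forms, whose moments vanish. -/
lemma Mollifier.integral_multilinear (ρ : Mollifier E 𝕜) {k : ℕ} (hk : 1 ≤ k)
    (M : ContinuousMultilinearMap ℝ (fun _ : Fin k => E) 𝕜) :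
    ∫ y, M (fun _ => y) * ρ.φ y = 0 := by
  classical
  let b := Module.finBasis ℝ E
  let m : Fin (Module.finrank ℝ E) → E →L[ℝ] ℝ := fun i => LinearMap.toContinuousLinearMap (b.coord i)
  have e : ∀ y, M (fun _ => y) * ρ.φ y = ∑ r : Fin k → Fin (Module.finrank ℝ E),
      M (fun j => b (r j)) * ((∏ j, m (r j) y) • ρ.φ y) := by
    intro y
    have h1 : M (fun _ => y) = M (fun _ => ∑ i, m i y • b i) := by
      congr 1
      funext _
      exact (b.sum_repr y).symm
    rw [h1, M.map_sum, Finset.sum_mul]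
    refine Finset.sum_congr rfl fun r _ => ?_
    rw [M.map_smul_univ]
    simp
  simp_rw [e]
  rw [integral_finsetSum]
  · refine Finset.sum_eq_zero fun r _ => ?_
    rw [integral_const_mul, ρ.moments_eq_zero k hk, mul_zero]
  · intro r _
    refine Integrable.const_mul ?_ _
    refine ((ρ.φ.integrable_pow_mul volume k).const_mul (∏ j, ‖m (r j)‖)).mono' ?_
      (Eventually.of_forall fun y => ?_)
    · have := ρ.φ.continuous
      exact Continuous.aestronglyMeasurable (by fun_prop)
    · rw [norm_smul, ← mul_assoc, norm_prod]
      refine mul_le_mul_of_nonneg_right ?_ (norm_nonneg _)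
      refine (Finset.prod_le_prod (fun _ _ => norm_nonneg _)
        fun j _ => (m (r j)).le_opNorm y).trans_eq ?_
      simp [Finset.prod_mul_distrib]

/-- The substitution t = ε y, whose Jacobian cancels the factor ε^(-n) of the kernel. -/
lemma Mollifier.regularize_eq (ρ : Mollifier E 𝕜) (g : E → 𝕜) (ε : Eps) (x : E) :
    ρ.regularize g ε x =
      ∫ y, g (x - (ε : ℝ) • y) * ρ.χ ((ε : ℝ) • y) * ρ.φ y := by
  have hε : (0 : ℝ) < ε := ε.2.1
  have h := Measure.integral_comp_inv_smul_of_nonneg (volume : Measure E)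
    (fun y => g (x - (ε : ℝ) • y) * ρ.χ ((ε : ℝ) • y) * ρ.φ y) hε.le
  rw [regularize, convolution_eq_swap, ← inv_smul_smul₀ (pow_pos hε (Module.finrank ℝ E)).ne'
    (∫ y, g (x - (ε : ℝ) • y) * ρ.χ ((ε : ℝ) • y) * ρ.φ y), ← h, ← integral_smul]
  congr 1
  funext t
  simp only [kernel, ContinuousLinearMap.mul_apply', smul_inv_smul₀ hε.ne', mul_smul_comm,
    mul_assoc]

/-- The cut-off is put with `g` rather than with φ, so that the moment conditions for φ apply
exactly. Taylor expansion of G(z) = g(x - z) χ(z) at 0 then leaves G(0) = g(x) and a remainder of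
order ε^(n+1). -/
lemma Mollifier.norm_regularize_sub_le (ρ : Mollifier E 𝕜) {g : E → 𝕜} (hg : ContDiff ℝ ∞ g)
    {n : ℕ} {B : ℝ} {x : E}
    (hB : ∀ z, ‖iteratedFDeriv ℝ (n + 1) (fun z => g (x - z) * ρ.χ z) z‖ ≤ B) (ε : Eps) :
    ‖ρ.regularize g ε x - g x‖ ≤
      B * (∫ y, ‖y‖ ^ (n + 1) * ‖ρ.φ y‖) * (ε : ℝ) ^ (n + 1) := by
  set G : E → 𝕜 := fun z => g (x - z) * ρ.χ z with hGdef
  have hG : ContDiff ℝ ∞ G := (hg.comp (contDiff_const.sub contDiff_id)).mul ρ.χ_smooth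
  have hε : (0 : ℝ) < ε := ε.2.1
  have hφ := ρ.φ.continuous
  let P : E → 𝕜 := fun y => ∑ k ∈ Finset.range (n + 1),
    ((ε : ℝ) ^ k * (k.factorial : ℝ)⁻¹) • iteratedFDeriv ℝ k G 0 (fun _ => y)
  have hterm : ∀ k : ℕ, Integrable (fun y => ((ε : ℝ) ^ k * (k.factorial : ℝ)⁻¹) •
      (iteratedFDeriv ℝ k G 0 (fun _ => y) * ρ.φ y)) := fun k =>
    Integrable.smul ((ε : ℝ) ^ k * (k.factorial : ℝ)⁻¹) (ρ.integrable_multilinear _)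
  have hPint : Integrable (fun y => P y * ρ.φ y) := by
    simp only [P, Finset.sum_mul, smul_mul_assoc]
    exact integrable_finsetSum _ fun k _ => hterm k
  have hPval : ∫ y, P y * ρ.φ y = g x := by
    simp only [P, Finset.sum_mul, smul_mul_assoc]
    rw [integral_finsetSum _ fun k _ => hterm k,
      Finset.sum_range_succ']
    have h0 : ∀ k ∈ Finset.range n, ∫ y, ((ε : ℝ) ^ (k + 1) * ((k + 1).factorial : ℝ)⁻¹) •
        (iteratedFDeriv ℝ (k + 1) G 0 (fun _ => y) * ρ.φ y) = 0 := fun k _ => by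
      rw [integral_smul, ρ.integral_multilinear (by lia), smul_zero]
    rw [Finset.sum_eq_zero h0]
    simp only [iteratedFDeriv_zero_apply, pow_zero, Nat.factorial_zero, Nat.cast_one, inv_one,
      mul_one, one_smul, zero_add]
    rw [integral_const_mul, ρ.integral_eq_one, hGdef]
    simp [ρ.χ_eq_one.self_of_nhds]
  -- Integral form of the remainder; the factors (1 - t)^n and 1/n! are bounded by 1.
  have hrem : ∀ y, ‖G ((ε : ℝ) • y) - P y‖ ≤ B * ‖y‖ ^ (n + 1) * (ε : ℝ) ^ (n + 1) := by
    intro y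
    have ht := map_add_eq_sum_add_integral_iteratedFDeriv (f := G) (x := 0) (y := (ε : ℝ) • y)
      (n := n) fun t _ => (hG.of_le (by exact_mod_cast le_top)).contDiffAt
    have hP : P y = ∑ k ∈ Finset.range (n + 1), (k.factorial : ℝ)⁻¹ •
        iteratedFDeriv ℝ k G 0 (fun _ => (ε : ℝ) • y) := by
      refine Finset.sum_congr rfl fun k _ => ?_
      rw [(iteratedFDeriv ℝ k G 0).map_smul_univ (fun _ => (ε : ℝ)) (fun _ => y)]
      simp [smul_smul, mul_comm]
    rw [zero_add] at ht
    rw [ht, hP, add_sub_cancel_left, norm_smul]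
    have hint : ‖∫ t in (0 : ℝ)..1, (1 - t) ^ n •
        iteratedFDeriv ℝ (n + 1) G (0 + t • (ε : ℝ) • y) (fun _ => (ε : ℝ) • y)‖ ≤
        B * ‖y‖ ^ (n + 1) * (ε : ℝ) ^ (n + 1) * |(1 : ℝ) - 0| := by
      refine intervalIntegral.norm_integral_le_of_norm_le_const fun t ht => ?_
      rw [uIoc_of_le zero_le_one] at ht
      have h1 : ‖(1 - t) ^ n‖ ≤ 1 := by
        rw [norm_pow]
        refine pow_le_one₀ (norm_nonneg _) ?_
        rw [Real.norm_of_nonneg (by linarith [ht.2])]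
        linarith [ht.1]
      have h2 : ‖iteratedFDeriv ℝ (n + 1) G (0 + t • (ε : ℝ) • y) (fun _ => (ε : ℝ) • y)‖ ≤
          B * ‖y‖ ^ (n + 1) * (ε : ℝ) ^ (n + 1) := by
        refine (ContinuousMultilinearMap.le_opNorm _ _).trans ?_
        rw [Finset.prod_const, Finset.card_univ, Fintype.card_fin, norm_smul,
          Real.norm_of_nonneg hε.le, mul_pow, mul_assoc, mul_comm ((ε : ℝ) ^ (n + 1))]
        exact mul_le_mul_of_nonneg_right (hB _) (by positivity)
      rw [norm_smul]
      exact (mul_le_of_le_one_left (norm_nonneg _) h1).trans h2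
    rw [sub_zero, abs_one, mul_one] at hint
    refine (mul_le_of_le_one_left (norm_nonneg _) ?_).trans hint
    rw [Real.norm_of_nonneg (by positivity)]
    exact inv_le_one_of_one_le₀ (by exact_mod_cast n.factorial_pos)
  have hrint := (ρ.φ.integrable_pow_mul volume (n + 1)).const_mul (B * (ε : ℝ) ^ (n + 1))
  have hle : ∀ y, ‖(G ((ε : ℝ) • y) - P y) * ρ.φ y‖ ≤
      B * (ε : ℝ) ^ (n + 1) * (‖y‖ ^ (n + 1) * ‖ρ.φ y‖) := fun y => by
    rw [norm_mul, ← mul_assoc, mul_right_comm B]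
    exact mul_le_mul_of_nonneg_right (hrem y) (norm_nonneg _)
  have hRint : Integrable (fun y => (G ((ε : ℝ) • y) - P y) * ρ.φ y) := by
    refine hrint.mono' ?_ (Eventually.of_forall hle)
    have hGc := hG.continuous
    exact Continuous.aestronglyMeasurable (by fun_prop)
  have heq : ρ.regularize g ε x - g x = ∫ y, (G ((ε : ℝ) • y) - P y) * ρ.φ y := by
    have h1 : (fun y => G ((ε : ℝ) • y) * ρ.φ y) =
        fun y => (G ((ε : ℝ) • y) - P y) * ρ.φ y + P y * ρ.φ y := by
      funext y
      ring
    have h2 : ρ.regularize g ε x = ∫ y, G ((ε : ℝ) • y) * ρ.φ y := ρ.regularize_eq g ε x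
    rw [h2, h1, integral_add hRint hPint, hPval, add_sub_cancel_right]
  rw [heq]
  refine (norm_integral_le_of_norm_le hrint (Eventually.of_forall hle)).trans_eq ?_
  rw [integral_const_mul]
  ring

lemma Mollifier.isNull_regularize_sub (ρ : Mollifier E 𝕜) {g : E → 𝕜} (hg : ContDiff ℝ ∞ g) :
    IsNull (fun ε x => ρ.regularize g ε x - g x) := by
  have : ProperSpace E := FiniteDimensional.proper ℝ E
  refine ((ρ.isModerate_regularize hg.continuous.locallyIntegrable).sub
    (IsModerate.const_family hg)).isNull fun K hK q => ?_
  -- Expansion to degree q leaves a remainder O(ε^(q+1)), one power better than required.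
  obtain ⟨B, hB⟩ := exists_bound_iteratedFDeriv_mul_cutoff hg ρ.χ_smooth ρ.χ_compact hK (q + 1)
  refine IsOrder.mono_exp (m := ((q + 1 : ℕ) : ℤ)) ?_ (by push_cast; lia)
  refine ⟨B * ∫ y, ‖y‖ ^ (q + 1) * ‖ρ.φ y‖, Eventually.of_forall fun ε x hx => ?_⟩
  rw [zpow_natCast]
  exact ρ.norm_regularize_sub_le hg (hB x hx) ε

/-- On smooth functions the embedding agrees with the embedding as constant families. -/
lemma embed_eq_mk_const (ρ : Mollifier E 𝕜) {g : E → 𝕜} (hg : ContDiff ℝ ∞ g) :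
    embed ρ g hg.continuous.locallyIntegrable = mk (fun _ => g) (IsModerate.const_family hg) :=
  (mk_eq_mk _ _).2 (ρ.isNull_regularize_sub hg)

end RegularizationOfSmoothFunctions

/-! ### The Cauchy problem in the Colombeau algebra. -/

section GeneralizedWaveEquation

variable {𝕜 : Type*} [RCLike 𝕜]

lemma dirDeriv_mk {E : Type*} [NormedAddCommGroup E] [NormedSpace ℝ E] (v : E) {w : Eps → E → 𝕜}
    (hw : IsModerate w) :
    (mk w hw).dirDeriv v = mk (fun ε => dirDeriv v (w ε)) (hw.dirDeriv v) := rfl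

lemma restrict_mk {w : Eps → ℝ × ℝ → 𝕜} (hw : IsModerate w) :
    (mk w hw).restrict = mk (fun ε x => w ε (x, 0)) (hw.pullback (ContinuousLinearMap.inl ℝ ℝ ℝ)) :=
  rfl

lemma IsModerate.superpos {E : Type*} [NormedAddCommGroup E] [NormedSpace ℝ E] {f : 𝕜 → 𝕜}
    (hf : f.HasTemperateGrowth) {w : Eps → E → 𝕜} (hw : IsModerate w) :
    IsModerate (fun ε x => f (w ε x)) :=
  ⟨fun ε => hf.1.comp (hw.1 ε), fun K hK k => modOn_superpos hw.1 (fun j => hw.2 K hK j) k hf⟩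

lemma superpos_mk {E : Type*} [NormedAddCommGroup E] [NormedSpace ℝ E] {f : 𝕜 → 𝕜}
    (hf : f.HasTemperateGrowth) {w : Eps → E → 𝕜} (hw : IsModerate w) :
    (mk w hw).superpos f hf = mk (fun ε x => f (w ε x)) (hw.superpos hf) := rfl

lemma mk_sub_mk {E : Type*} [NormedAddCommGroup E] [NormedSpace ℝ E] {w w' : Eps → E → 𝕜}
    (hw : IsModerate w) (hw' : IsModerate w') :
    mk w hw - mk w' hw' = mk (fun ε x => w ε x - w' ε x) (hw.sub hw') := rfl

lemma mk_add_mk {E : Type*} [NormedAddCommGroup E] [NormedSpace ℝ E] {w w' : Eps → E → 𝕜}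
    (hw : IsModerate w) (hw' : IsModerate w') :
    mk w hw + mk w' hw' = mk (fun ε x => w ε x + w' ε x) (hw.add hw') := rfl

variable {f : 𝕜 → 𝕜} (hf : f.HasTemperateGrowth)

/-- The equations in the Colombeau algebras, in terms of representatives. -/
lemma isGenSolution_mk_iff {a b : Eps → ℝ → 𝕜} {h u : Eps → ℝ × ℝ → 𝕜} (ha : IsModerate a)
    (hb : IsModerate b) (hh : IsModerate h) (hu : IsModerate u) :
    IsGenSolution f hf (mk a ha) (mk b hb) (mk h hh) (mk u hu) ↔
      IsNull (fun ε p => (dirDeriv dt (dirDeriv dt (u ε)) p - dirDeriv dx (dirDeriv dx (u ε)) p) -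
        (f (u ε p) + h ε p)) ∧
      IsNull (fun ε x => u ε (x, 0) - a ε x) ∧
      IsNull (fun ε x => dirDeriv dt (u ε) (x, 0) - b ε x) := by
  constructor
  · intro hs
    have h1 := hs.wave
    have h2 := hs.initial
    have h3 := hs.initial_dt
    simp only [dirDeriv_mk, restrict_mk, superpos_mk, mk_sub_mk, mk_add_mk] at h1 h2 h3
    exact ⟨(mk_eq_mk _ _).1 h1, (mk_eq_mk _ _).1 h2, (mk_eq_mk _ _).1 h3⟩
  · rintro ⟨h1, h2, h3⟩
    refine ⟨?_, ?_, ?_⟩ <;>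
      simp only [dirDeriv_mk, restrict_mk, superpos_mk, mk_sub_mk, mk_add_mk]
    exacts [(mk_eq_mk _ _).2 h1, (mk_eq_mk _ _).2 h2, (mk_eq_mk _ _).2 h3]

variable {a b : ℝ → 𝕜} {h w : ℝ × ℝ → 𝕜}

lemma isGenSolution_of_isClassicalSolution (hs : IsClassicalSolution f a b h w)
    (ha : ContDiff ℝ ∞ a) (hb : ContDiff ℝ ∞ b) (hh : ContDiff ℝ ∞ h) (hw : ContDiff ℝ ∞ w) :
    IsGenSolution f hf (mk (fun _ => a) (IsModerate.const_family ha))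
      (mk (fun _ => b) (IsModerate.const_family hb)) (mk (fun _ => h) (IsModerate.const_family hh))
      (mk (fun _ => w) (IsModerate.const_family hw)) := by
  rw [isGenSolution_mk_iff]
  refine ⟨?_, ?_, ?_⟩
  · convert! IsNull.zero (E := ℝ × ℝ) (F := 𝕜) using 3 with ε p
    exact sub_eq_zero.2 (hs.wave p.1 p.2)
  · convert! IsNull.zero (E := ℝ) (F := 𝕜) using 3 with ε x
    exact sub_eq_zero.2 (hs.initial x)
  · convert! IsNull.zero (E := ℝ) (F := 𝕜) using 3 with ε x
    exact sub_eq_zero.2 (hs.initial_dt x)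

/-- For a representative `u`, the difference u - w has null Cauchy data and satisfies the wave
equation with source f(u) - f(w) plus a null term. The a priori bound gives null estimates of order
zero, and these suffice. -/
lemma eq_mk_of_isGenSolution {L : NNReal} (hL : LipschitzWith L f)
    (hs : IsClassicalSolution f a b h w)
    (ha : ContDiff ℝ ∞ a) (hb : ContDiff ℝ ∞ b) (hh : ContDiff ℝ ∞ h) (hw : ContDiff ℝ ∞ w)
    {U : GenFun (ℝ × ℝ) 𝕜}
    (hU : IsGenSolution f hf (mk (fun _ => a) (IsModerate.const_family ha))
      (mk (fun _ => b) (IsModerate.const_family hb)) (mk (fun _ => h) (IsModerate.const_family hh))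
      U) : U = mk (fun _ => w) (IsModerate.const_family hw) := by
  obtain ⟨⟨u, hu⟩, rfl⟩ := Ideal.Quotient.mk_surjective U
  change IsGenSolution f hf _ _ _ (mk u hu) at hU
  change mk u hu = _
  obtain ⟨hwave, hinit, hinit_dt⟩ := (isGenSolution_mk_iff hf _ _ _ _).1 hU
  -- The a priori bound also needs the tangential derivative of the initial difference, which is
  -- null because null families are closed under differentiation.
  have hinit_dx := hinit.dirDeriv (1 : ℝ)
  refine (mk_eq_mk _ _).2 (IsModerate.isNull (IsModerate.sub hu (IsModerate.const_family hw))
    fun K hK q => ?_)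
  obtain ⟨T, hT, hKT⟩ := exists_subset_diamond hK
  obtain ⟨C, hC⟩ := exists_bound_of_wave (F := 𝕜) L.coe_nonneg hT
  obtain ⟨C₁, h₁⟩ := hwave.nullOn (isCompact_diamond T) q
  obtain ⟨C₂, h₂⟩ := hinit.nullOn (isCompact_Icc (a := -T) (b := T)) q
  obtain ⟨C₃, h₃⟩ := hinit_dx.nullOn (isCompact_Icc (a := -T) (b := T)) q
  obtain ⟨C₄, h₄⟩ := hinit_dt.nullOn (isCompact_Icc (a := -T) (b := T)) q
  -- One nonnegative constant dominating all four estimates, so that δ = B ε^q is admissible.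
  set B := |C₁| + |C₂| + |C₃| + |C₄| with hB
  refine ⟨C * B, ?_⟩
  filter_upwards [h₁, h₂, h₃, h₄] with ε e₁ e₂ e₃ e₄ p hp
  have hε : (0 : ℝ) < (ε : ℝ) ^ (q : ℤ) := zpow_pos ε.2.1 _
  have hu2 : ContDiff ℝ 2 (u ε) := contDiff_infty.1 (hu.1 ε) 2
  have hw2 := hs.contDiff
  have hud := hu2.differentiable two_ne_zero
  have hwd := hw2.differentiable two_ne_zero
  have hle : ∀ {c : ℝ}, c ≤ B → c * (ε : ℝ) ^ (q : ℤ) ≤ B * (ε : ℝ) ^ (q : ℤ) := fun hc =>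
    mul_le_mul_of_nonneg_right hc hε.le
  have a₁ := abs_nonneg C₁
  have a₂ := abs_nonneg C₂
  have a₃ := abs_nonneg C₃
  have a₄ := abs_nonneg C₄
  rw [mul_assoc]
  refine hC (fun p => u ε p - w p) (B * (ε : ℝ) ^ (q : ℤ)) (hu2.sub hw2) (by positivity)
    (fun s hs' => ?_) (fun s hs' => ?_) (fun s hs' => ?_) (fun r hr => ?_) p (hKT hp)
  · rw [hs.initial]
    exact (e₂ s hs').trans (hle (by linarith [le_abs_self C₂]))
  · have e := congrFun (dirDeriv_comp_clm (ContinuousLinearMap.inl ℝ ℝ ℝ) (1 : ℝ)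
      (hud.sub hwd)) s
    have e' : (fun y : ℝ => (u ε - w) (ContinuousLinearMap.inl ℝ ℝ ℝ y)) =
        fun y => u ε (y, 0) - a y := by
      funext y
      rw [← hs.initial]
      rfl
    rw [e'] at e
    refine (congrArg norm e).symm.le.trans ((e₃ s hs').trans (hle ?_))
    linarith [le_abs_self C₃]
  · rw [dirDeriv_sub _ hud hwd]
    beta_reduce
    rw [hs.initial_dt]
    exact (e₄ s hs').trans (hle (by linarith [le_abs_self C₄]))
  · rw [dirDeriv_dirDeriv_sub _ _ hu2 hw2, dirDeriv_dirDeriv_sub _ _ hu2 hw2]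
    have hwr := hs.wave r.1 r.2
    simp only [Prod.mk.eta] at hwr
    have e : (dirDeriv dt (dirDeriv dt (u ε)) r - dirDeriv dt (dirDeriv dt w) r) -
        (dirDeriv dx (dirDeriv dx (u ε)) r - dirDeriv dx (dirDeriv dx w) r) =
        (f (u ε r) - f (w r)) + ((dirDeriv dt (dirDeriv dt (u ε)) r -
          dirDeriv dx (dirDeriv dx (u ε)) r) - (f (u ε r) + h r)) := by
      rw [sub_sub_sub_comm, hwr]
      ring
    beta_reduce
    rw [e]
    exact norm_add_le_of_le (hL.norm_sub_le _ _)
      ((e₁ r hr).trans (hle (by linarith [le_abs_self C₁])))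

end GeneralizedWaveEquation

end Colombeau

end

theorem mainTheorem5 {𝕜 : Type*} [RCLike 𝕜] (f : 𝕜 → 𝕜) (hf : f.HasTemperateGrowth)
    (hLip : ∃ L : NNReal, LipschitzWith L f) (hf0 : f 0 = 0)
    (ρ₁ : Colombeau.Mollifier ℝ 𝕜) (ρ₂ : Colombeau.Mollifier (ℝ × ℝ) 𝕜)
    (a b : ℝ → 𝕜) (h : ℝ × ℝ → 𝕜)
    (ha : ContDiff ℝ ∞ a) (hb : ContDiff ℝ ∞ b) (hh : ContDiff ℝ ∞ h) :
    ∃ w : ℝ × ℝ → 𝕜, ∃ hw : ContDiff ℝ ∞ w,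
      Colombeau.IsClassicalSolution f a b h w ∧
      (∀ w' : ℝ × ℝ → 𝕜, Colombeau.IsClassicalSolution f a b h w' → w' = w) ∧
      (∀ u : Colombeau.GenFun (ℝ × ℝ) 𝕜,
        Colombeau.IsGenSolution f hf
          (Colombeau.embed ρ₁ a ha.continuous.locallyIntegrable)
          (Colombeau.embed ρ₁ b hb.continuous.locallyIntegrable)
          (Colombeau.embed ρ₂ h hh.continuous.locallyIntegrable) u ↔
        u = Colombeau.embed ρ₂ w hw.continuous.locallyIntegrable) := by
  obtain ⟨L, hL⟩ := hLip
  obtain ⟨w, hw, hs⟩ := Colombeau.exists_smooth_classicalSolution hf.1 hL ha hb hh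
  refine ⟨w, hw, hs, fun w' hw' => hs.unique hL hw', fun u => ?_⟩
  -- All four functions are smooth, so the mollifiers drop out and only constant families remain.
  rw [Colombeau.embed_eq_mk_const ρ₁ ha, Colombeau.embed_eq_mk_const ρ₁ hb,
    Colombeau.embed_eq_mk_const ρ₂ hh, Colombeau.embed_eq_mk_const ρ₂ hw]
  constructor
  · exact Colombeau.eq_mk_of_isGenSolution hf hL hs ha hb hh hw
  · rintro rfl
    exact Colombeau.isGenSolution_of_isClassicalSolution hf hs ha hb hh hw
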